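/- Let $n\ge 1$ and let $M$ be a smooth manifold of dimension $4n$ with a hypercomplex structure $H=(J_1,J_2,J_3)$, i.e. smooth integrable almost complex structures with $J_1J_2=-J_2J_1=J_3$. Let $g$ be a pseudo-Hermitian metric on $(M,H)$, i.e. a smooth symmetric nondegenerate $(0,2)$-tensor field with $g(J_1x,J_1y)=-g(J_2x,J_2y)=-g(J_3x,J_3y)=g(x,y)$. Let $\nabla$ be the Levi-Civita connection of $g$ and, for $\alpha=1,2,3$, $$F_\alpha(x,y,z)=g\big((\nabla_xJ_\alpha)y,z\big),\qquad \theta_\alpha(z)=g^{ij}F_\alpha(e_i,e_j,z).$$ $(M,H,g)$ belongs to the class $\mathcal W$ if $$F_1(x,y,z)=\tfrac{1}{2(2n-1)}\big[g(x,y)\theta_1(z)-g(x,z)\theta_1(y)-g(x,J_1y)\theta_1(J_1z)+g(x,J_1z)\theta_1(J_1y)\big]$$ and, for $\alpha=2,3$, $$F_\alpha(x,y,z)=\tfrac{1}{4n}\big[g(x,y)\theta_\alpha(z)+g(x,z)\theta_\alpha(y)+g(x,J_\alpha y)\theta_\alpha(J_\alpha z)+g(x,J_\alpha z)\theta_\alpha(J_\alpha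 y)\big].$$ It belongs to $\mathcal W^0$ if it belongs to $\mathcal W$ and $d(\theta_1\circ J_1)=0$. For an open set $U\subseteq M$ and a pseudo-Hermitian metric $\tilde g$ on $U$, $(U,H,\tilde g)$ is pseudo-hyper-Kähler if $\tilde\nabla J_1=\tilde\nabla J_2=\tilde\nabla J_3=0$ for the Levi-Civita connection $\tilde\nabla$ of $\tilde g$. (i) $(M,H,g)$ belongs to $\mathcal W^0$ if and only if it is locally conformally equivalent to a pseudo-hyper-Kähler manifold, i.e. every point has an open neighbourhood $U$ and a smooth function $u:U\to\mathbb R$ such that $(U,H,e^{2u}g)$ is pseudo-hyper-Kähler. (ii) Let $(M,H,g)$ belong to $\mathcal W^0$. Then every point has an open neighbourhood $U$ on which the equation $$du=-\tfrac{1}{2(2n-1)}\,\theta_1\circ J_1$$ has a smooth solution $u$; and for every open set $U\subseteq M$ (for instance $U=M$) and every smooth solution $u$ of this equation on $U$, $(U,H,e^{2u}g)$ is pseudo-hyper-Kähler. -/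

import Mathlib

open Set Bundle
open scoped Manifold ContDiff Topology

noncomputable section

namespace PseudoHyper

section TensorFields

variable (n : ℕ) (M : Type*) [TopologicalSpace M]
  [ChartedSpace (EuclideanSpace ℝ (Fin (4 * n))) M]

/-- Vector fields on a `4n`-dimensional manifold. -/
abbrev VField := Π p : M, TangentSpace (𝓡 (4 * n)) p

/-- Fields of endomorphisms of the tangent spaces. -/
abbrev EndField :=
  Π p : M, TangentSpace (𝓡 (4 * n)) p →L[ℝ] TangentSpace (𝓡 (4 * n)) p

/-- Tensor fields of type (0,2). -/
abbrev BilinField :=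
  Π p : M, TangentSpace (𝓡 (4 * n)) p →L[ℝ] TangentSpace (𝓡 (4 * n)) p →L[ℝ] ℝ

/-- Differential 1-forms. -/
abbrev OneForm := Π p : M, TangentSpace (𝓡 (4 * n)) p →L[ℝ] ℝ

/-- The underlying function of a connection on the tangent bundle, with Mathlib's argument order:
`D Y p x` stands for `∇_x Y` at the point `p`. -/
abbrev Conn := VField n M →
  Π p : M, TangentSpace (𝓡 (4 * n)) p →L[ℝ] TangentSpace (𝓡 (4 * n)) p

end TensorFields

variable {n : ℕ} {M : Type*} [TopologicalSpace M]
  [ChartedSpace (EuclideanSpace ℝ (Fin (4 * n))) M]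

/-- The vector field `J X`. -/
def appEnd (J : EndField n M) (X : VField n M) : VField n M := fun p => J p (X p)

/-- The pullback `φ ∘ J` of a 1-form by an endomorphism field. -/
def compEnd (φ : OneForm n M) (J : EndField n M) : OneForm n M :=
  fun p => (φ p).comp (J p)

/-- The `i`-th vector of the standard coordinate basis of `T_p M`. -/
def basisVec (p : M) (i : Fin (4 * n)) : TangentSpace (𝓡 (4 * n)) p :=
  (EuclideanSpace.single i (1 : ℝ) : EuclideanSpace ℝ (Fin (4 * n)))

/-- The matrix `g_{ij}` of the metric in the basis `basisVec p`. -/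
def gram (g : BilinField n M) (p : M) : Matrix (Fin (4 * n)) (Fin (4 * n)) ℝ :=
  Matrix.of fun i j => g p (basisVec p i) (basisVec p j)

/-- The conformally changed metric `e^{2u} g`. -/
def conformal (u : M → ℝ) (g : BilinField n M) : BilinField n M :=
  fun p => Real.exp (2 * u p) • g p

variable [IsManifold (𝓡 (4 * n)) ∞ M]

/-- The vector field `X` is smooth (`C^∞`) at the point `p`. -/
def SmoothFieldAt (X : VField n M) (p : M) : Prop :=
  ContMDiffAt (𝓡 (4 * n)) (𝓡 (4 * n)).tangent ∞
    (fun q => (⟨q, X q⟩ : TangentBundle (𝓡 (4 * n)) M)) p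

/-- The vector field `X` is differentiable at the point `p`. -/
def DiffFieldAt (X : VField n M) (p : M) : Prop :=
  MDifferentiableAt (𝓡 (4 * n)) (𝓡 (4 * n)).tangent
    (fun q => (⟨q, X q⟩ : TangentBundle (𝓡 (4 * n)) M)) p

/-- Vanishing of the Nijenhuis tensor of `J`. -/
def IsIntegrable (J : EndField n M) : Prop :=
  ∀ (p : M) (X Y : VField n M),
    SmoothFieldAt X p →
    SmoothFieldAt Y p →
    VectorField.mlieBracket (𝓡 (4 * n)) (appEnd J X) (appEnd J Y) p
      - J p (VectorField.mlieBracket (𝓡 (4 * n)) (appEnd J X) Y p)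
      - J p (VectorField.mlieBracket (𝓡 (4 * n)) X (appEnd J Y) p)
      - VectorField.mlieBracket (𝓡 (4 * n)) X Y p = 0

/-- `D` is a Levi-Civita connection of the metric `g` over the open set `U`:
a torsion-free connection which is compatible with `g`. -/
structure IsLeviCivitaOn (g : BilinField n M) (D : Conn n M) (U : Set M) : Prop where
  isCovariantDerivativeOn :
    IsCovariantDerivativeOn (I := 𝓡 (4 * n)) (EuclideanSpace ℝ (Fin (4 * n))) D U
  torsion_free : ∀ p ∈ U, ∀ X Y : VField n M,
    DiffFieldAt X p → DiffFieldAt Y p →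
    D Y p (X p) - D X p (Y p) = VectorField.mlieBracket (𝓡 (4 * n)) X Y p
  metric : ∀ p ∈ U, ∀ (x : TangentSpace (𝓡 (4 * n)) p) (Y Z : VField n M),
    DiffFieldAt Y p → DiffFieldAt Z p →
    mvfderiv (𝓡 (4 * n)) (fun q => g q (Y q) (Z q)) p x
      = g p (D Y p x) (Z p) + g p (Y p) (D Z p x)

section Structures

variable (n M)

/-- A hypercomplex structure: smooth anticommuting integrable almost complex structures
`J₁, J₂, J₃` with `J₃ = J₁ J₂`. -/
structure HypercomplexStructure where
  J₁ : EndField n M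
  J₂ : EndField n M
  J₃ : EndField n M
  smooth₁ : ContMDiff (𝓡 (4 * n)) ((𝓡 (4 * n)).prod
    𝓘(ℝ, EuclideanSpace ℝ (Fin (4 * n)) →L[ℝ] EuclideanSpace ℝ (Fin (4 * n)))) ∞
    (fun p => TotalSpace.mk'
      (EuclideanSpace ℝ (Fin (4 * n)) →L[ℝ] EuclideanSpace ℝ (Fin (4 * n))) p (J₁ p))
  smooth₂ : ContMDiff (𝓡 (4 * n)) ((𝓡 (4 * n)).prod
    𝓘(ℝ, EuclideanSpace ℝ (Fin (4 * n)) →L[ℝ] EuclideanSpace ℝ (Fin (4 * n)))) ∞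
    (fun p => TotalSpace.mk'
      (EuclideanSpace ℝ (Fin (4 * n)) →L[ℝ] EuclideanSpace ℝ (Fin (4 * n))) p (J₂ p))
  smooth₃ : ContMDiff (𝓡 (4 * n)) ((𝓡 (4 * n)).prod
    𝓘(ℝ, EuclideanSpace ℝ (Fin (4 * n)) →L[ℝ] EuclideanSpace ℝ (Fin (4 * n)))) ∞
    (fun p => TotalSpace.mk'
      (EuclideanSpace ℝ (Fin (4 * n)) →L[ℝ] EuclideanSpace ℝ (Fin (4 * n))) p (J₃ p))
  sq₁ : ∀ p x, J₁ p (J₁ p x) = -x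
  sq₂ : ∀ p x, J₂ p (J₂ p x) = -x
  sq₃ : ∀ p x, J₃ p (J₃ p x) = -x
  mul₁₂ : ∀ p x, J₁ p (J₂ p x) = J₃ p x
  mul₂₁ : ∀ p x, J₂ p (J₁ p x) = -J₃ p x
  integrable₁ : IsIntegrable J₁
  integrable₂ : IsIntegrable J₂
  integrable₃ : IsIntegrable J₃

end Structures

/-- `g` is a pseudo-Hermitian metric over the open set `U`: a smooth symmetric nondegenerate
(0,2)-tensor field which is Hermitian with respect to `J₁` and skew-Hermitian with respect to
`J₂` and `J₃` (the signature is then necessarily `(2n,2n)`). -/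
structure IsPseudoHermitianOn (H : HypercomplexStructure n M) (g : BilinField n M)
    (U : Set M) : Prop where
  smooth : ContMDiffOn (𝓡 (4 * n)) ((𝓡 (4 * n)).prod
    𝓘(ℝ, EuclideanSpace ℝ (Fin (4 * n)) →L[ℝ] EuclideanSpace ℝ (Fin (4 * n)) →L[ℝ] ℝ)) ∞
    (fun p => TotalSpace.mk'
      (EuclideanSpace ℝ (Fin (4 * n)) →L[ℝ] EuclideanSpace ℝ (Fin (4 * n)) →L[ℝ] ℝ) p (g p)) U
  symm : ∀ p ∈ U, ∀ x y, g p x y = g p y x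
  nondegenerate : ∀ p ∈ U, ∀ x, (∀ y, g p x y = 0) → x = 0
  hermitian₁ : ∀ p ∈ U, ∀ x y, g p (H.J₁ p x) (H.J₁ p y) = g p x y
  skew₂ : ∀ p ∈ U, ∀ x y, g p (H.J₂ p x) (H.J₂ p y) = -g p x y
  skew₃ : ∀ p ∈ U, ∀ x y, g p (H.J₃ p x) (H.J₃ p y) = -g p x y

/-- `(∇_x J) y = ∇_x (J Y) - J (∇_x Y)` at the point `p`, where `Y` is a local smooth vector field
extending `y`. -/
def nablaEnd (D : Conn n M) (J : EndField n M) (p : M) (x y : TangentSpace (𝓡 (4 * n)) p) :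
    TangentSpace (𝓡 (4 * n)) p :=
  D (appEnd J (FiberBundle.extend (EuclideanSpace ℝ (Fin (4 * n))) y)) p x
    - J p (D (FiberBundle.extend (EuclideanSpace ℝ (Fin (4 * n))) y) p x)

/-- The structural tensor `F(x,y,z) = g((∇_x J) y, z)`, as a linear form in `z`. -/
def structTensor (g : BilinField n M) (D : Conn n M) (J : EndField n M) (p : M)
    (x y : TangentSpace (𝓡 (4 * n)) p) : TangentSpace (𝓡 (4 * n)) p →L[ℝ] ℝ :=
  g p (nablaEnd D J p x y)

/-- The structural 1-form `θ(z) = g^{ij} F(e_i, e_j, z)`. -/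
def structForm (g : BilinField n M) (D : Conn n M) (J : EndField n M) : OneForm n M :=
  fun p => ∑ i, ∑ j,
    ((gram g p)⁻¹ i j) • structTensor g D J p (basisVec p i) (basisVec p j)

/-- The class `𝒲(J₁)` (the Gray-Hervella class `𝒲₄` with respect to `J = J₁`). -/
def InClassWHermitian (g : BilinField n M) (D : Conn n M) (J : EndField n M) : Prop :=
  ∀ (p : M) (x y z : TangentSpace (𝓡 (4 * n)) p),
    structTensor g D J p x y z
      = 1 / (2 * (2 * (n : ℝ) - 1)) *
        (g p x y * structForm g D J p z - g p x z * structForm g D J p y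
          - g p x (J p y) * structForm g D J p (J p z)
          + g p x (J p z) * structForm g D J p (J p y))

/-- The classes `𝒲(J₂)` and `𝒲(J₃)` (the class `𝒲₁` of almost complex manifolds with
skew-Hermitian metric, for `J = J₂` and `J = J₃`). -/
def InClassWNorden (g : BilinField n M) (D : Conn n M) (J : EndField n M) : Prop :=
  ∀ (p : M) (x y z : TangentSpace (𝓡 (4 * n)) p),
    structTensor g D J p x y z
      = 1 / (4 * (n : ℝ)) *
        (g p x y * structForm g D J p z + g p x z * structForm g D J p y
          + g p x (J p y) * structForm g D J p (J p z)
          + g p x (J p z) * structForm g D J p (J p y))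

/-- The class `𝒲 = 𝒲(J₁) ∩ 𝒲(J₂) ∩ 𝒲(J₃)`; here `D` is the Levi-Civita connection of `g`. -/
def InClassW (H : HypercomplexStructure n M) (g : BilinField n M) (D : Conn n M) : Prop :=
  InClassWHermitian g D H.J₁ ∧ InClassWNorden g D H.J₂ ∧ InClassWNorden g D H.J₃

/-- `φ` is a closed (smooth) 1-form: `dφ(X,Y) = X(φ(Y)) - Y(φ(X)) - φ([X,Y]) = 0`. -/
structure IsClosedForm (φ : OneForm n M) : Prop where
  smooth : ContMDiff (𝓡 (4 * n)) ((𝓡 (4 * n)).prod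
    𝓘(ℝ, EuclideanSpace ℝ (Fin (4 * n)) →L[ℝ] ℝ)) ∞
    (fun p => TotalSpace.mk' (EuclideanSpace ℝ (Fin (4 * n)) →L[ℝ] ℝ) p (φ p))
  closed : ∀ (p : M) (X Y : VField n M),
    SmoothFieldAt X p →
    SmoothFieldAt Y p →
    mvfderiv (𝓡 (4 * n)) (fun q => φ q (Y q)) p (X p)
      - mvfderiv (𝓡 (4 * n)) (fun q => φ q (X q)) p (Y p)
      - φ p (VectorField.mlieBracket (𝓡 (4 * n)) X Y p) = 0

/-- The defining conditions of the class `𝒲⁰` for the metric `g` with Levi-Civita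
connection `D`: the class `𝒲` and `d(θ₁ ∘ J₁) = 0`. -/
def InClassWZero (H : HypercomplexStructure n M) (g : BilinField n M) (D : Conn n M) : Prop :=
  InClassW H g D ∧ IsClosedForm (compEnd (structForm g D H.J₁) H.J₁)

/-- `(M,H,g)` is in the class `𝒲⁰`. (The Levi-Civita connection is unique, so that the
existential quantifier merely names it.) -/
def IsWZero (H : HypercomplexStructure n M) (g : BilinField n M) : Prop :=
  ∃ D : Conn n M, IsLeviCivitaOn g D univ ∧ InClassWZero H g D

/-- `(U,H,g)` is a pseudo-hyper-Kähler manifold: `g` is a pseudo-Hermitian metric over `U`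
whose Levi-Civita connection satisfies `∇J₁ = ∇J₂ = ∇J₃ = 0`. -/
def IsPseudoHyperKahlerOn (H : HypercomplexStructure n M) (g : BilinField n M)
    (U : Set M) : Prop :=
  IsPseudoHermitianOn H g U ∧
  ∃ D : Conn n M, IsLeviCivitaOn g D U ∧
    ∀ p ∈ U, ∀ x y : TangentSpace (𝓡 (4 * n)) p,
      nablaEnd D H.J₁ p x y = 0 ∧ nablaEnd D H.J₂ p x y = 0 ∧ nablaEnd D H.J₃ p x y = 0

/-- `(M,H,g)` is locally conformally equivalent to a pseudo-hyper-Kähler manifold. -/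
def IsLocallyConformallyPseudoHyperKahler (H : HypercomplexStructure n M)
    (g : BilinField n M) : Prop :=
  ∀ p : M, ∃ U : Set M, IsOpen U ∧ p ∈ U ∧ ∃ u : M → ℝ,
    ContMDiffOn (𝓡 (4 * n)) 𝓘(ℝ, ℝ) ∞ u U ∧ IsPseudoHyperKahlerOn H (conformal u g) U

/-- The equation `du = -(1/(2(2n-1))) θ₁ ∘ J₁` over `U`. -/
def SolvesPotentialEq (H : HypercomplexStructure n M) (g : BilinField n M) (D : Conn n M)
    (u : M → ℝ) (U : Set M) : Prop :=
  ∀ p ∈ U, ∀ x : TangentSpace (𝓡 (4 * n)) p,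
    mvfderiv (𝓡 (4 * n)) u p x
      = -(1 / (2 * (2 * (n : ℝ) - 1))) * compEnd (structForm g D H.J₁) H.J₁ p x

end PseudoHyper

end

/-! The Levi-Civita connection of `e^{2u} g` differs from that of `g` by an algebraic term in `du`,
so `(∇_x J) y` changes by an explicit expression, `conformalDefect`, with `η = du` and `s` its
metric dual. Everything rests on recognising this expression in the class `𝒲`: the condition on each
`J_α` says that `∇J_α` is minus the defect of a 1-form `η_α`, where `η₁ = -θ₁∘J₁/(2(2n-1))` and `η_α
= θ_α∘J_α/(4n)` for `α = 2, 3`.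

A priori the three forms differ. The product rule `∇J₃ = (∇J₁)J₂ + J₁(∇J₂)` forces them to agree
(`forms_eq_of_product_rule`). Hence once `du = η₁`, the single function `u` removes all three
covariant derivatives; this is `nablaEnd_conformalConn_eq_zero`. Closedness of `θ₁∘J₁` provides such
a `u` locally by the Poincaré lemma (`exists_local_primitive`).

Conversely, undoing a conformal change to a pseudo-hyper-Kähler metric gives `∇J_α =
-conformalDefect` with the same `η = du` for every `α`. Taking the metric trace computes the `θ_α`,
and substituting them back yields the identities of `𝒲` (`classW_of_nablaEnd`). Moreover `θ₁∘J₁ =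
-2(2n-1) du` locally, so this form is smooth and closed. Uniqueness of the Levi-Civita connection
reconciles the local descriptions. -/

noncomputable section

namespace PseudoHyper

section

/-! ### Linear algebra of the conformal defect on a single tangent space. -/

section Algebra

variable {V : Type*} [AddCommGroup V] [Module ℝ V]

/-- The value on `(x, y)` of the change of `∇J` under the conformal change of the metric `B` with
differential `η`, where `s` is the vector dual to `η`. -/
def conformalDefect (B : V →ₗ[ℝ] V →ₗ[ℝ] ℝ) (J : V →ₗ[ℝ] V) (η : V →ₗ[ℝ] ℝ) (s x y : V) : V :=
  η (J y) • x - B x (J y) • s - η y • J x + B x y • J s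

lemma exists_dual_vector [FiniteDimensional ℝ V] {B : V →ₗ[ℝ] V →ₗ[ℝ] ℝ}
    (hB : ∀ x, (∀ y, B x y = 0) → x = 0) (η : V →ₗ[ℝ] ℝ) : ∃ s, ∀ z, B s z = η z := by
  have hinj : Function.Injective B := by
    rw [injective_iff_map_eq_zero]
    intro x hx
    exact hB x fun y => by rw [hx]; rfl
  obtain ⟨s, hs⟩ := (LinearMap.injective_iff_surjective_of_finrank_eq_finrank
    (Subspace.dual_finrank_eq (K := ℝ) (V := V)).symm).1 hinj η
  exact ⟨s, fun z => by rw [hs]⟩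

/-- A linear map to `ℝ³` has a kernel once the dimension exceeds three. It supplies a vector
orthogonal to `y`, `J₂ y` and `J₃ y`, which kills every metric term in the product rule; this is how
the dimension `4n ≥ 4` enters. -/
lemma exists_ne_zero_of_three_forms [FiniteDimensional ℝ V] (hV : 3 < Module.finrank ℝ V)
    (f₁ f₂ f₃ : V →ₗ[ℝ] ℝ) : ∃ x, x ≠ 0 ∧ f₁ x = 0 ∧ f₂ x = 0 ∧ f₃ x = 0 := by
  have h : LinearMap.ker (LinearMap.pi ![f₁, f₂, f₃]) ≠ ⊥ :=
    LinearMap.ker_ne_bot_of_finrank_lt (by simpa using hV)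
  obtain ⟨x, hx, hx0⟩ := (Submodule.ne_bot_iff _).1 h
  rw [LinearMap.mem_ker] at hx
  exact ⟨x, hx0, congrFun hx 0, congrFun hx 1, congrFun hx 2⟩

/-- A nontrivial combination of `1, J₁, J₃` is injective. -/
lemma coeff_eq_zero_of_quaternion {J₁ J₃ : V →ₗ[ℝ] V} (h₁ : ∀ x, J₁ (J₁ x) = -x)
    (h₃ : ∀ x, J₃ (J₃ x) = -x) (h₁₃ : ∀ x, J₁ (J₃ x) = -J₃ (J₁ x)) {x : V} (hx : x ≠ 0)
    {a b c : ℝ} (h : a • x + b • J₁ x + c • J₃ x = 0) : a = 0 ∧ b = 0 ∧ c = 0 := by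
  have key : (a ^ 2 + b ^ 2 + c ^ 2) • x = 0 := by
    -- Apply the quaternionic conjugate `a - b J₁ - c J₃`: the mixed terms cancel by anticommutation
    -- and leave the norm.
    have e : a • (a • x + b • J₁ x + c • J₃ x) - b • J₁ (a • x + b • J₁ x + c • J₃ x)
        - c • J₃ (a • x + b • J₁ x + c • J₃ x) = 0 := by
      rw [h]; simp
    rw [← e]
    simp only [map_add, map_smul, h₁, h₃, h₁₃]
    module
  have h0 : a ^ 2 + b ^ 2 + c ^ 2 = 0 := (smul_eq_zero.1 key).resolve_right hx
  refine ⟨?_, ?_, ?_⟩ <;> nlinarith [sq_nonneg a, sq_nonneg b, sq_nonneg c]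

/-- If the conformal defects of `J₁, J₂` and `J₃ = J₁J₂` satisfy the product rule,
then their 1-forms coincide. -/
lemma forms_eq_of_product_rule [FiniteDimensional ℝ V] (hV : 3 < Module.finrank ℝ V)
    {B : V →ₗ[ℝ] V →ₗ[ℝ] ℝ} {J₁ J₂ J₃ : V →ₗ[ℝ] V}
    (h₁ : ∀ x, J₁ (J₁ x) = -x) (h₂ : ∀ x, J₂ (J₂ x) = -x) (h₃ : ∀ x, J₃ (J₃ x) = -x)
    (h₁₂ : ∀ x, J₁ (J₂ x) = J₃ x) (h₁₃ : ∀ x, J₁ (J₃ x) = -J₃ (J₁ x))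
    {η₁ η₂ η₃ : V →ₗ[ℝ] ℝ} {s₁ s₂ s₃ : V}
    (h : ∀ x y, conformalDefect B J₃ η₃ s₃ x y
      = conformalDefect B J₁ η₁ s₁ x (J₂ y) + J₁ (conformalDefect B J₂ η₂ s₂ x y)) :
    η₂ = η₁ ∧ η₃ = η₁ := by
  have key : ∀ y, η₁ (J₃ y) = η₃ (J₃ y) ∧ η₂ (J₂ y) = η₁ (J₂ y) := by
    intro y
    obtain ⟨x, hx, e₁, e₂, e₃⟩ := exists_ne_zero_of_three_forms hV
      (B.flip y) (B.flip (J₂ y)) (B.flip (J₃ y))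
    simp only [LinearMap.flip_apply] at e₁ e₂ e₃
    have hxy := h x y
    simp only [conformalDefect, map_add, map_sub, map_smul, h₁₂, e₁, e₂, e₃, zero_smul] at hxy
    -- With the metric terms gone, the dual vectors `s₁, s₂, s₃` have dropped out, and only
    -- multiples of `x`, `J₁ x`, `J₃ x` remain to be compared.
    have := coeff_eq_zero_of_quaternion h₁ h₃ h₁₃ hx
      (a := η₁ (J₃ y) - η₃ (J₃ y)) (b := η₂ (J₂ y) - η₁ (J₂ y)) (c := η₃ y - η₂ y)
      (by
        rw [← sub_eq_zero] at hxy
        rw [← neg_eq_zero, ← hxy]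
        module)
    exact ⟨sub_eq_zero.1 this.1, sub_eq_zero.1 this.2.1⟩
  constructor
  · ext y
    have := (key (-J₂ y)).2
    simpa [h₂] using this
  · ext y
    have := (key (-J₃ y)).1
    simpa [h₃] using this.symm

/-- Since `C² = -1`, `A = -ACC`, while anticommutation gives `A = CAC`; cyclicity of the trace then
yields `tr A = -tr A`. -/
lemma trace_eq_zero_of_anticommute [FiniteDimensional ℝ V] {A C : V →ₗ[ℝ] V} (hC : ∀ x, C (C x) = -x)
    (hAC : ∀ x, A (C x) = -C (A x)) : LinearMap.trace ℝ V A = 0 := by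
  have e₁ : A = -((A ∘ₗ C) ∘ₗ C) := by ext x; simp [hC]
  have e₂ : A = C ∘ₗ (A ∘ₗ C) := by ext x; simp [hC, hAC]
  have e₃ : LinearMap.trace ℝ V A = -LinearMap.trace ℝ V ((A ∘ₗ C) ∘ₗ C) := by
    rw [← map_neg, ← e₁]
  rw [LinearMap.trace_comp_comm', ← e₂] at e₃
  linarith

/-- Contraction with the inverse Gram matrix computes traces. -/
lemma sum_gram_inv_mul {ι : Type*} [Fintype ι] [DecidableEq ι] (b : Module.Basis ι ℝ V)
    {B : V →ₗ[ℝ] V →ₗ[ℝ] ℝ} (hs : ∀ x y, B x y = B y x)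
    (hB : ∀ x, (∀ y, B x y = 0) → x = 0) (A : V →ₗ[ℝ] V) :
    ∑ i, ∑ j, (Matrix.of fun i j => B (b i) (b j))⁻¹ i j * B (b i) (A (b j))
      = LinearMap.trace ℝ V A := by
  set G : Matrix ι ι ℝ := Matrix.of fun i j => B (b i) (b j) with hG
  have hdet : G.det ≠ 0 := by
    have hn : LinearMap.BilinForm.Nondegenerate B := by
      refine ⟨fun x hx => hB x hx, fun x hx => hB x fun y => ?_⟩
      rw [hs]; exact hx y
    have := (LinearMap.BilinForm.nondegenerate_iff_det_ne_zero b).1 hn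
    convert this using 2
    ext i j
    simp [hG]
  have hGs : G.transpose = G := by ext i j; simp [hG, hs (b j) (b i)]
  have hGi : G⁻¹.transpose * G = 1 := by
    rw [Matrix.transpose_nonsing_inv, hGs, Matrix.nonsing_inv_mul _ (isUnit_iff_ne_zero.2 hdet)]
  rw [LinearMap.trace_eq_matrix_trace ℝ b]
  have h1 : ∀ i j, B (b i) (A (b j)) = (G * LinearMap.toMatrix b b A) i j := by
    intro i j
    have := congrArg (B (b i)) (b.sum_repr (A (b j)))
    rw [← this, map_sum]
    simp [Matrix.mul_apply, hG, LinearMap.toMatrix_apply, mul_comm]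
  have h2 : LinearMap.toMatrix b b A = G⁻¹.transpose * (G * LinearMap.toMatrix b b A) := by
    rw [← Matrix.mul_assoc, hGi, Matrix.one_mul]
  conv_rhs => rw [h2]
  rw [Finset.sum_comm]
  simp [Matrix.trace, Matrix.mul_apply (M := G⁻¹.transpose), h1]

/-- By nondegeneracy it is enough to pair with `z`. There `J` is skew-adjoint and `c θ = η ∘ J`, so
the four terms of the Hermitian class condition are those of the defect up to sign. -/
lemma eq_neg_conformalDefect_of_hermitian {B : V →ₗ[ℝ] V →ₗ[ℝ] ℝ} {J : V →ₗ[ℝ] V}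
    (hB : ∀ x, (∀ y, B x y = 0) → x = 0)
    (hJ : ∀ x, J (J x) = -x) (hBJ : ∀ x y, B (J x) (J y) = B x y)
    {θ η : V →ₗ[ℝ] ℝ} {c : ℝ} (hη : ∀ z, η z = -c * θ (J z)) {s : V} (hsη : ∀ z, B s z = η z)
    {x y N : V} (hN : ∀ z, B N z = c * (B x y * θ z - B x z * θ y
      - B x (J y) * θ (J z) + B x (J z) * θ (J y))) :
    N = -conformalDefect B J η s x y := by
  have hskew : ∀ a b, B (J a) b = -B a (J b) := fun a b => by
    have := hBJ a (J b)
    rw [hJ, map_neg] at this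
    linarith
  rw [← add_eq_zero_iff_eq_neg]
  refine hB _ fun z => ?_
  simp only [conformalDefect, map_add, map_sub, map_smul, LinearMap.add_apply,
    LinearMap.sub_apply, LinearMap.smul_apply, smul_eq_mul, hskew, hsη, hN, hη, hJ, map_neg]
  ring

/-- The same comparison with `J` self-adjoint; the change of adjointness accounts for the opposite
sign in the relation between `η` and `θ`. -/
lemma eq_neg_conformalDefect_of_norden {B : V →ₗ[ℝ] V →ₗ[ℝ] ℝ} {J : V →ₗ[ℝ] V}
    (hB : ∀ x, (∀ y, B x y = 0) → x = 0)
    (hJ : ∀ x, J (J x) = -x) (hBJ : ∀ x y, B (J x) (J y) = -B x y)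
    {θ η : V →ₗ[ℝ] ℝ} {c : ℝ} (hη : ∀ z, η z = c * θ (J z)) {s : V} (hsη : ∀ z, B s z = η z)
    {x y N : V} (hN : ∀ z, B N z = c * (B x y * θ z + B x z * θ y
      + B x (J y) * θ (J z) + B x (J z) * θ (J y))) :
    N = -conformalDefect B J η s x y := by
  have hsymm : ∀ a b, B (J a) b = B a (J b) := fun a b => by
    have := hBJ a (J b)
    rw [hJ, map_neg] at this
    linarith
  rw [← add_eq_zero_iff_eq_neg]
  refine hB _ fun z => ?_
  simp only [conformalDefect, map_add, map_sub, map_smul, LinearMap.add_apply,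
    LinearMap.sub_apply, LinearMap.smul_apply, smul_eq_mul, hsymm, hsη, hN, hη, hJ, map_neg]
  ring

/-- Moving all operators onto `y` writes the paired defect as `B x (T y)`, so the contraction is `tr
T`. The two rank-one terms of `T` contribute `η (J z)` and `-ε η (J z)`, the identity term
contributes the dimension times `ε η (J z)`, and the term in `J` is traceless. -/
lemma sum_gram_inv_conformalDefect {ι : Type*} [Fintype ι] [DecidableEq ι]
    (b : Module.Basis ι ℝ V) {B : V →ₗ[ℝ] V →ₗ[ℝ] ℝ} {J : V →ₗ[ℝ] V}
    (hs : ∀ x y, B x y = B y x) (hB : ∀ x, (∀ y, B x y = 0) → x = 0)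
    {ε : ℝ} (hBJ : ∀ x y, B (J x) y = ε * B x (J y)) (htr : LinearMap.trace ℝ V J = 0)
    {η : V →ₗ[ℝ] ℝ} {s : V} (hsη : ∀ z, B s z = η z) (z : V) :
    ∑ i, ∑ j, (Matrix.of fun i j => B (b i) (b j))⁻¹ i j
        * B (conformalDefect B J η s (b i) (b j)) z
      = (1 - ε + Fintype.card ι * ε) * η (J z) := by
  have : Module.Finite ℝ V := .of_basis b
  have hcomb : ∀ x y, B (conformalDefect B J η s x y) z
      = B x ((LinearMap.smulRight (η ∘ₗ J) z - η z • J
        - ε • LinearMap.smulRight η (J z) + (ε * η (J z)) • LinearMap.id : V →ₗ[ℝ] V) y) := by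
    intro x y
    simp only [conformalDefect, map_add, map_sub, map_smul, LinearMap.add_apply,
      LinearMap.sub_apply, LinearMap.smul_apply, smul_eq_mul, hBJ, hsη,
      LinearMap.smulRight_apply, LinearMap.comp_apply, LinearMap.id_apply]
    ring
  simp only [hcomb]
  rw [sum_gram_inv_mul b hs hB]
  simp only [map_add, map_sub, map_smul, htr, LinearMap.trace_smulRight, LinearMap.trace_id,
    Module.finrank_eq_card_basis b, smul_eq_mul, LinearMap.comp_apply]
  ring

lemma hermitian_formula_of_eq_neg_conformalDefect {B : V →ₗ[ℝ] V →ₗ[ℝ] ℝ} {J : V →ₗ[ℝ] V}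
    (hJ : ∀ x, J (J x) = -x) (hBJ : ∀ x y, B (J x) y = -B x (J y))
    {θ η : V →ₗ[ℝ] ℝ} {c k : ℝ} (hck : c * k = 1) (hθ : ∀ z, θ z = k * η (J z))
    {s : V} (hsη : ∀ z, B s z = η z) (x y z : V) :
    -B (conformalDefect B J η s x y) z = c * (B x y * θ z - B x z * θ y
      - B x (J y) * θ (J z) + B x (J z) * θ (J y)) := by
  simp only [conformalDefect, map_add, map_sub, map_smul, LinearMap.add_apply,
    LinearMap.sub_apply, LinearMap.smul_apply, smul_eq_mul, hBJ, hsη, hθ, hJ, map_neg]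
  linear_combination (-(B x y * η (J z) - B x z * η (J y) + B x (J y) * η z
    - B x (J z) * η y)) * hck

lemma norden_formula_of_eq_neg_conformalDefect {B : V →ₗ[ℝ] V →ₗ[ℝ] ℝ} {J : V →ₗ[ℝ] V}
    (hJ : ∀ x, J (J x) = -x) (hBJ : ∀ x y, B (J x) y = B x (J y))
    {θ η : V →ₗ[ℝ] ℝ} {c k : ℝ} (hck : c * k = 1) (hθ : ∀ z, θ z = -k * η (J z))
    {s : V} (hsη : ∀ z, B s z = η z) (x y z : V) :
    -B (conformalDefect B J η s x y) z = c * (B x y * θ z + B x z * θ y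
      + B x (J y) * θ (J z) + B x (J z) * θ (J y)) := by
  simp only [conformalDefect, map_add, map_sub, map_smul, LinearMap.add_apply,
    LinearMap.sub_apply, LinearMap.smul_apply, smul_eq_mul, hBJ, hsη, hθ, hJ, map_neg]
  linear_combination (B x y * η (J z) + B x z * η (J y) - B x (J y) * η z
    - B x (J z) * η y) * hck

end Algebra

end

/-! ### Tangent spaces, metric duals and the conformal change of the Levi-Civita connection. -/

section

variable {n : ℕ} {M : Type*} [TopologicalSpace M]
  [ChartedSpace (EuclideanSpace ℝ (Fin (4 * n))) M]

section Fiber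

instance (p : M) : FiniteDimensional ℝ (TangentSpace (𝓡 (4 * n)) p) :=
  inferInstanceAs (FiniteDimensional ℝ (EuclideanSpace ℝ (Fin (4 * n))))

instance (p : M) : T2Space (TangentSpace (𝓡 (4 * n)) p) :=
  inferInstanceAs (T2Space (EuclideanSpace ℝ (Fin (4 * n))))

lemma finrank_tangentSpace (p : M) : Module.finrank ℝ (TangentSpace (𝓡 (4 * n)) p) = 4 * n :=
  finrank_euclideanSpace_fin

/-- The standard coordinate basis of `T_p M`. -/
def tangentBasis (p : M) : Module.Basis (Fin (4 * n)) ℝ (TangentSpace (𝓡 (4 * n)) p) :=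
  (EuclideanSpace.basisFun (Fin (4 * n)) ℝ).toBasis

lemma tangentBasis_apply (p : M) (i : Fin (4 * n)) : tangentBasis p i = basisVec p i := by
  change (EuclideanSpace.basisFun (Fin (4 * n)) ℝ).toBasis i = EuclideanSpace.single i 1
  rw [OrthonormalBasis.coe_toBasis, EuclideanSpace.basisFun_apply]

/-- The value of the metric at a point as an algebraic bilinear form. -/
def fiberForm (g : BilinField n M) (p : M) :
    TangentSpace (𝓡 (4 * n)) p →ₗ[ℝ] TangentSpace (𝓡 (4 * n)) p →ₗ[ℝ] ℝ :=
  LinearMap.mk₂ ℝ (fun x y => g p x y) (by simp) (by simp) (by simp) (by simp)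

@[simp] lemma fiberForm_apply (g : BilinField n M) (p : M) (x y : TangentSpace (𝓡 (4 * n)) p) :
    fiberForm g p x y = g p x y := rfl

open Classical in
/-- The vector dual to the 1-form `φ` at `p` with respect to `g` (zero if there is none). -/
def sharp (g : BilinField n M) (φ : OneForm n M) (p : M) : TangentSpace (𝓡 (4 * n)) p :=
  if h : ∃ s, ∀ z, g p s z = φ p z then h.choose else 0

lemma apply_sharp {g : BilinField n M} {p : M} (hg : ∀ x, (∀ y, g p x y = 0) → x = 0)
    (φ : OneForm n M) (z : TangentSpace (𝓡 (4 * n)) p) : g p (sharp g φ p) z = φ p z := by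
  have h : ∃ s, ∀ z, g p s z = φ p z := exists_dual_vector (B := fiberForm g p) hg (φ p)
  rw [sharp, dif_pos h]
  exact h.choose_spec z

end Fiber

/-- The Levi-Civita connection of `e^{2u} g` in terms of that of `g`. -/
def conformalConn (g : BilinField n M) (u : M → ℝ) (D : Conn n M) : Conn n M := fun Y p =>
  D Y p + (mvfderiv (𝓡 (4 * n)) u p).smulRight (Y p)
    + mvfderiv (𝓡 (4 * n)) u p (Y p) • ContinuousLinearMap.id ℝ _
    - (LinearMap.toContinuousLinearMap ((fiberForm g p).flip (Y p))).smulRight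
      (sharp g (mvfderiv (𝓡 (4 * n)) u) p)

lemma conformalConn_apply (g : BilinField n M) (u : M → ℝ) (D : Conn n M) (Y : VField n M) (p : M)
    (x : TangentSpace (𝓡 (4 * n)) p) :
    conformalConn g u D Y p x = D Y p x + mvfderiv (𝓡 (4 * n)) u p x • Y p
      + mvfderiv (𝓡 (4 * n)) u p (Y p) • x
      - g p x (Y p) • sharp g (mvfderiv (𝓡 (4 * n)) u) p := rfl

variable [IsManifold (𝓡 (4 * n)) ∞ M]

lemma diffFieldAt_extend {p : M} (y : TangentSpace (𝓡 (4 * n)) p) :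
    DiffFieldAt (FiberBundle.extend (EuclideanSpace ℝ (Fin (4 * n))) y) p :=
  FiberBundle.mdifferentiableAt_extend ..

lemma diffFieldAt_appEnd {J : EndField n M} {X : VField n M} {p : M}
    (hJ : ContMDiff (𝓡 (4 * n)) ((𝓡 (4 * n)).prod
      𝓘(ℝ, EuclideanSpace ℝ (Fin (4 * n)) →L[ℝ] EuclideanSpace ℝ (Fin (4 * n)))) ∞
      (fun p => TotalSpace.mk'
        (EuclideanSpace ℝ (Fin (4 * n)) →L[ℝ] EuclideanSpace ℝ (Fin (4 * n))) p (J p)))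
    (hX : DiffFieldAt X p) : DiffFieldAt (appEnd J X) p :=
  ((hJ p).mdifferentiableAt (by simp)).clm_bundle_apply hX

lemma mdifferentiableAt_metric_apply {g : BilinField n M} {X Y : VField n M} {p : M}
    (hg : ContMDiffAt (𝓡 (4 * n)) ((𝓡 (4 * n)).prod
      𝓘(ℝ, EuclideanSpace ℝ (Fin (4 * n)) →L[ℝ] EuclideanSpace ℝ (Fin (4 * n)) →L[ℝ] ℝ)) ∞
      (fun p => TotalSpace.mk'
        (EuclideanSpace ℝ (Fin (4 * n)) →L[ℝ] EuclideanSpace ℝ (Fin (4 * n)) →L[ℝ] ℝ) p (g p)) p)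
    (hX : DiffFieldAt X p) (hY : DiffFieldAt Y p) :
    MDifferentiableAt (𝓡 (4 * n)) 𝓘(ℝ, ℝ) (fun q => g q (X q) (Y q)) p := by
  have := MDifferentiableAt.clm_bundle_apply₂ (E₃ := fun _ : M => ℝ)
    (hg.mdifferentiableAt (by simp)) hX hY
  simpa [mdifferentiableAt_section] using this

/-- The terms `du(x) J y` cancel in the commutator with `J`; the other correction terms are exactly
the defect. -/
lemma nablaEnd_conformalConn (g : BilinField n M) (u : M → ℝ) (D : Conn n M) (J : EndField n M)
    (p : M) (x y : TangentSpace (𝓡 (4 * n)) p) :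
    nablaEnd (conformalConn g u D) J p x y = nablaEnd D J p x y
      + conformalDefect (fiberForm g p) (J p).toLinearMap
        (mvfderiv (𝓡 (4 * n)) u p).toLinearMap (sharp g (mvfderiv (𝓡 (4 * n)) u) p) x y := by
  simp only [nablaEnd, conformalConn_apply, appEnd, conformalDefect, FiberBundle.extend_apply_self,
    map_add, map_sub, map_smul, fiberForm_apply, ContinuousLinearMap.coe_coe]
  module

/-- The correction is symmetric in its two vector arguments, so torsion is unchanged. In the metric
condition its `du(Y)` and `du(Z)` terms cancel, and what is left, `2 du(x) g(Y,Z)`, matches the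
derivative of the factor `e^{2u}`. -/
lemma isLeviCivitaOn_conformalConn {g : BilinField n M} {u : M → ℝ} {D : Conn n M} {U : Set M}
    (hU : IsOpen U)
    (hg : ContMDiffOn (𝓡 (4 * n)) ((𝓡 (4 * n)).prod
      𝓘(ℝ, EuclideanSpace ℝ (Fin (4 * n)) →L[ℝ] EuclideanSpace ℝ (Fin (4 * n)) →L[ℝ] ℝ)) ∞
      (fun p => TotalSpace.mk'
        (EuclideanSpace ℝ (Fin (4 * n)) →L[ℝ] EuclideanSpace ℝ (Fin (4 * n)) →L[ℝ] ℝ) p (g p)) U)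
    (hs : ∀ p ∈ U, ∀ x y, g p x y = g p y x)
    (hnd : ∀ p ∈ U, ∀ x, (∀ y, g p x y = 0) → x = 0)
    (hu : ContMDiffOn (𝓡 (4 * n)) 𝓘(ℝ, ℝ) ∞ u U)
    (hD : IsLeviCivitaOn g D U) : IsLeviCivitaOn (conformal u g) (conformalConn g u D) U where
  isCovariantDerivativeOn :=
    { add := by
        intro X Y p hX hY hp
        ext1 x
        have := hD.isCovariantDerivativeOn.add hX hY hp
        simp only [conformalConn_apply, this, Pi.add_apply, map_add, add_apply]
        module
      leibniz := by
        intro X f p hX hf hp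
        ext1 x
        have := hD.isCovariantDerivativeOn.leibniz hX hf hp
        simp only [conformalConn_apply, this, Pi.smul_apply', map_smul,
          add_apply, smul_apply,
          ContinuousLinearMap.smulRight_apply, smul_eq_mul]
        module }
  torsion_free := by
    intro p hp X Y hX hY
    rw [← hD.torsion_free p hp X Y hX hY, conformalConn_apply, conformalConn_apply,
      hs p hp (X p) (Y p)]
    module
  metric := by
    intro p hp x Y Z hY hZ
    have hgp := mdifferentiableAt_metric_apply (hg.contMDiffAt (hU.mem_nhds hp)) hY hZ
    have hup : MDifferentiableAt (𝓡 (4 * n)) 𝓘(ℝ, ℝ) u p :=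
      (hu.contMDiffAt (hU.mem_nhds hp)).mdifferentiableAt (by simp)
    have he : HasMFDerivAt (𝓡 (4 * n)) 𝓘(ℝ, ℝ) (fun q => Real.exp (2 * u q)) p
        ((Real.exp (2 * u p) * 2) • mfderiv (𝓡 (4 * n)) 𝓘(ℝ, ℝ) u p) := by
      have hexp : HasFDerivAt (fun t : ℝ => Real.exp (2 * t))
          ((Real.exp (2 * u p) * 2) • ContinuousLinearMap.id ℝ ℝ) (u p) := by
        have h : HasDerivAt (fun t : ℝ => Real.exp (2 * t)) (Real.exp (2 * u p) * 2) (u p) := by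
          simpa using ((hasDerivAt_id (u p)).const_mul 2).exp
        refine h.hasFDerivAt.congr_fderiv ?_
        ext
        simp
      exact hexp.hasMFDerivAt.comp p hup.hasMFDerivAt
    have he' : mvfderiv (𝓡 (4 * n)) (fun q => Real.exp (2 * u q)) p x
        = Real.exp (2 * u p) * 2 * mvfderiv (𝓡 (4 * n)) u p x :=
      congrArg (fun L => L x) he.mfderiv
    have hmul := congrArg (fun L => L x) (mvfderiv_fun_mul he.mdifferentiableAt hgp)
    simp only [add_apply, smul_apply, smul_eq_mul, he', hD.metric p hp x Y Z hY hZ] at hmul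
    refine hmul.trans ?_
    simp only [conformal, conformalConn_apply, map_add, map_sub, map_smul, add_apply, sub_apply,
      smul_apply, smul_eq_mul, apply_sharp (hnd p hp), hs p hp (Y p) (sharp _ _ _),
      hs p hp (Y p) x]
    ring

end

/-! ### The class `𝒲` expressed through conformal defects. -/

section

variable {n : ℕ} {M : Type*} [TopologicalSpace M]
  [ChartedSpace (EuclideanSpace ℝ (Fin (4 * n))) M]

lemma conformal_neg_conformal (g : BilinField n M) (u : M → ℝ) :
    conformal (fun p => -u p) (conformal u g) = g := by
  funext p
  simp [conformal, smul_smul, ← Real.exp_add]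

variable [IsManifold (𝓡 (4 * n)) ∞ M]

lemma IsPseudoHermitianOn.mono {H : HypercomplexStructure n M} {g : BilinField n M} {U V : Set M}
    (hg : IsPseudoHermitianOn H g V) (h : U ⊆ V) : IsPseudoHermitianOn H g U where
  smooth := hg.smooth.mono h
  symm p hp := hg.symm p (h hp)
  nondegenerate p hp := hg.nondegenerate p (h hp)
  hermitian₁ p hp := hg.hermitian₁ p (h hp)
  skew₂ p hp := hg.skew₂ p (h hp)
  skew₃ p hp := hg.skew₃ p (h hp)

lemma IsPseudoHermitianOn.conformal {H : HypercomplexStructure n M} {g : BilinField n M}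
    {U : Set M} (hg : IsPseudoHermitianOn H g U) {u : M → ℝ}
    (hu : ContMDiffOn (𝓡 (4 * n)) 𝓘(ℝ, ℝ) ∞ u U) :
    IsPseudoHermitianOn H (conformal u g) U where
  smooth := by
    have he : ContMDiffOn (𝓡 (4 * n)) 𝓘(ℝ, ℝ) ∞ (fun p => Real.exp (2 * u p)) U :=
      (Real.contDiff_exp.comp (contDiff_const.mul contDiff_id)).contMDiff.comp_contMDiffOn hu
    exact he.smul_section hg.smooth
  symm p hp x y := by simp [PseudoHyper.conformal, hg.symm p hp x y]
  nondegenerate p hp x h := hg.nondegenerate p hp x fun y => by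
    simpa [PseudoHyper.conformal, Real.exp_ne_zero] using h y
  hermitian₁ p hp x y := by simp [PseudoHyper.conformal, hg.hermitian₁ p hp x y]
  skew₂ p hp x y := by simp [PseudoHyper.conformal, hg.skew₂ p hp x y]
  skew₃ p hp x y := by simp [PseudoHyper.conformal, hg.skew₃ p hp x y]

/-- `Y ↦ ∇(J Y) - J ∇Y` is tensorial. -/
lemma nablaEnd_apply_eq {D : Conn n M} {U : Set M} {J : EndField n M} {p : M} (hp : p ∈ U)
    (hD : IsCovariantDerivativeOn (I := 𝓡 (4 * n)) (EuclideanSpace ℝ (Fin (4 * n))) D U)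
    (hJ : ContMDiff (𝓡 (4 * n)) ((𝓡 (4 * n)).prod
      𝓘(ℝ, EuclideanSpace ℝ (Fin (4 * n)) →L[ℝ] EuclideanSpace ℝ (Fin (4 * n)))) ∞
      (fun p => TotalSpace.mk'
        (EuclideanSpace ℝ (Fin (4 * n)) →L[ℝ] EuclideanSpace ℝ (Fin (4 * n))) p (J p)))
    (x : TangentSpace (𝓡 (4 * n)) p) {Y : VField n M} (hY : DiffFieldAt Y p) :
    nablaEnd D J p x (Y p) = D (appEnd J Y) p x - J p (D Y p x) := by
  have hT : TensorialAt (𝓡 (4 * n)) (EuclideanSpace ℝ (Fin (4 * n)))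
      (fun Y : VField n M => D (appEnd J Y) p x - J p (D Y p x)) p := by
    constructor
    · intro f Y hf hY
      have e : appEnd J (f • Y) = f • appEnd J Y := by
        funext q; simp [appEnd]
      rw [e, hD.leibniz hY hf hp, hD.leibniz (diffFieldAt_appEnd hJ hY) hf hp]
      simp [appEnd, smul_sub]
    · intro Y Z hY hZ
      have e : appEnd J (Y + Z) = appEnd J Y + appEnd J Z := by
        funext q; simp [appEnd]
      rw [e, hD.add hY hZ hp, hD.add (diffFieldAt_appEnd hJ hY) (diffFieldAt_appEnd hJ hZ) hp]
      simp only [add_apply, map_add]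
      abel
  exact hT.pointwise (diffFieldAt_extend _) hY (by simp)

/-- This is the Leibniz rule for `J₃ = J₁J₂`. The field `J₂ Y` extends `J₂ y` but need not be its
chosen extension, so tensoriality of `∇J₁` is needed. -/
lemma nablaEnd_J₃ {H : HypercomplexStructure n M} {D : Conn n M} {U : Set M} {p : M} (hp : p ∈ U)
    (hD : IsCovariantDerivativeOn (I := 𝓡 (4 * n)) (EuclideanSpace ℝ (Fin (4 * n))) D U)
    (x y : TangentSpace (𝓡 (4 * n)) p) :
    nablaEnd D H.J₃ p x y
      = nablaEnd D H.J₁ p x (H.J₂ p y) + H.J₁ p (nablaEnd D H.J₂ p x y) := by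
  have hy := diffFieldAt_extend y
  have e : H.J₂ p y = appEnd H.J₂ (FiberBundle.extend (EuclideanSpace ℝ (Fin (4 * n))) y) p := by
    simp [appEnd]
  have e₃ : ∀ Y, appEnd H.J₃ Y = appEnd H.J₁ (appEnd H.J₂ Y) := fun Y => by
    funext q; simp [appEnd, H.mul₁₂]
  rw [e, nablaEnd_apply_eq hp hD H.smooth₁ x (diffFieldAt_appEnd H.smooth₂ hy)]
  simp only [nablaEnd, e₃, map_sub, H.mul₁₂]
  abel

lemma structForm_apply (g : BilinField n M) (D : Conn n M) (J : EndField n M) (p : M)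
    (z : TangentSpace (𝓡 (4 * n)) p) :
    structForm g D J p z = ∑ i, ∑ j, (Matrix.of fun i j =>
      fiberForm g p (tangentBasis p i) (tangentBasis p j))⁻¹ i j
        * fiberForm g p (nablaEnd D J p (tangentBasis p i) (tangentBasis p j)) z := by
  simp [structForm, structTensor, gram, tangentBasis_apply]

lemma HypercomplexStructure.mul₁₃ (H : HypercomplexStructure n M) (p : M)
    (x : TangentSpace (𝓡 (4 * n)) p) : H.J₁ p (H.J₃ p x) = -H.J₃ p (H.J₁ p x) := by
  rw [← H.mul₁₂ p (H.J₁ p x), H.mul₂₁, map_neg, neg_neg]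

/-- Over a solution of the potential equation a metric of the class `𝒲` becomes
pseudo-hyper-Kähler. -/
lemma nablaEnd_conformalConn_eq_zero (hn : 1 ≤ n) {H : HypercomplexStructure n M}
    {g : BilinField n M} (hg : IsPseudoHermitianOn H g univ) {D : Conn n M}
    (hD : IsLeviCivitaOn g D univ) (hW : InClassW H g D) {u : M → ℝ} {p : M}
    (hu : ∀ x : TangentSpace (𝓡 (4 * n)) p, mvfderiv (𝓡 (4 * n)) u p x
      = -(1 / (2 * (2 * (n : ℝ) - 1))) * compEnd (structForm g D H.J₁) H.J₁ p x)
    (x y : TangentSpace (𝓡 (4 * n)) p) :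
    nablaEnd (conformalConn g u D) H.J₁ p x y = 0
      ∧ nablaEnd (conformalConn g u D) H.J₂ p x y = 0
      ∧ nablaEnd (conformalConn g u D) H.J₃ p x y = 0 := by
  obtain ⟨hW₁, hW₂, hW₃⟩ := hW
  have hp := mem_univ p
  set B := fiberForm g p with hBdef
  have hB : ∀ x, (∀ y, B x y = 0) → x = 0 := hg.nondegenerate p hp
  set du := mvfderiv (𝓡 (4 * n)) u with hdu
  set s₁ := sharp g du p
  have hs₁ : ∀ z, B s₁ z = (du p).toLinearMap z := apply_sharp (hg.nondegenerate p hp) du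
  -- The 1-forms dictated by the conditions on `J₂` and `J₃`; that they equal `du` at `p` emerges
  -- only from the product rule below.
  set η₂ := ((1 / (4 * (n : ℝ))) • (structForm g D H.J₂ p).comp (H.J₂ p)).toLinearMap with hη₂
  set η₃ := ((1 / (4 * (n : ℝ))) • (structForm g D H.J₃ p).comp (H.J₃ p)).toLinearMap with hη₃
  obtain ⟨s₂, hs₂⟩ := exists_dual_vector hB η₂
  obtain ⟨s₃, hs₃⟩ := exists_dual_vector hB η₃
  have d₁ : ∀ x y, nablaEnd D H.J₁ p x y
      = -conformalDefect B (H.J₁ p).toLinearMap (du p).toLinearMap s₁ x y := fun x y =>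
    eq_neg_conformalDefect_of_hermitian (θ := (structForm g D H.J₁ p).toLinearMap) hB
      (H.sq₁ p) (hg.hermitian₁ p hp) hu hs₁ (hW₁ p x y)
  have d₂ : ∀ x y, nablaEnd D H.J₂ p x y
      = -conformalDefect B (H.J₂ p).toLinearMap η₂ s₂ x y := fun x y =>
    eq_neg_conformalDefect_of_norden (θ := (structForm g D H.J₂ p).toLinearMap) hB
      (H.sq₂ p) (hg.skew₂ p hp) (fun z => rfl) hs₂ (hW₂ p x y)
  have d₃ : ∀ x y, nablaEnd D H.J₃ p x y
      = -conformalDefect B (H.J₃ p).toLinearMap η₃ s₃ x y := fun x y =>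
    eq_neg_conformalDefect_of_norden (θ := (structForm g D H.J₃ p).toLinearMap) hB
      (H.sq₃ p) (hg.skew₃ p hp) (fun z => rfl) hs₃ (hW₃ p x y)
  have hfin : 3 < Module.finrank ℝ (TangentSpace (𝓡 (4 * n)) p) := by
    rw [finrank_tangentSpace]; omega
  obtain ⟨e₂, e₃⟩ := forms_eq_of_product_rule (B := B) (J₁ := (H.J₁ p).toLinearMap)
    (J₂ := (H.J₂ p).toLinearMap) (J₃ := (H.J₃ p).toLinearMap)
    (η₁ := (du p).toLinearMap) (s₁ := s₁) (η₂ := η₂) (s₂ := s₂) (η₃ := η₃) (s₃ := s₃) hfin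
    (H.sq₁ p) (H.sq₂ p) (H.sq₃ p) (H.mul₁₂ p) (H.mul₁₃ p) (fun x y => by
      have := nablaEnd_J₃ (H := H) hp hD.isCovariantDerivativeOn x y
      rw [d₁, d₂, d₃, map_neg] at this
      rw [← neg_inj, this, neg_add]
      rfl)
  have hdual : ∀ s, (∀ z, B s z = (du p).toLinearMap z) → s = s₁ := fun s hs => by
    rw [← sub_eq_zero]
    refine hB _ fun z => ?_
    rw [map_sub, LinearMap.sub_apply, hs, hs₁, sub_self]
  rw [e₂] at hs₂ d₂
  rw [e₃] at hs₃ d₃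
  obtain rfl := hdual s₂ hs₂
  obtain rfl := hdual s₃ hs₃
  simp only [nablaEnd_conformalConn, d₁, d₂, d₃]
  refine ⟨neg_add_cancel _, neg_add_cancel _, neg_add_cancel _⟩

/-- If `∇J` is minus the conformal defect, then the Lee form of `J` is determined. -/
lemma structForm_eq_of_nablaEnd {g : BilinField n M} {D : Conn n M} {J : EndField n M} {p : M}
    (hs : ∀ x y, g p x y = g p y x) (hB : ∀ x, (∀ y, g p x y = 0) → x = 0)
    {ε : ℝ} (hBJ : ∀ x y, g p (J p x) y = ε * g p x (J p y))
    (htr : LinearMap.trace ℝ _ (J p).toLinearMap = 0)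
    {η : TangentSpace (𝓡 (4 * n)) p →ₗ[ℝ] ℝ} {s : TangentSpace (𝓡 (4 * n)) p}
    (hsη : ∀ z, g p s z = η z)
    (hN : ∀ x y, nablaEnd D J p x y = -conformalDefect (fiberForm g p) (J p).toLinearMap η s x y)
    (z : TangentSpace (𝓡 (4 * n)) p) :
    structForm g D J p z = -(1 - ε + 4 * n * ε) * η (J p z) := by
  rw [structForm_apply]
  have := sum_gram_inv_conformalDefect (tangentBasis p) (B := fiberForm g p)
    (J := (J p).toLinearMap) hs hB hBJ htr hsη z
  simp only [hN, map_neg, LinearMap.neg_apply, mul_neg, Finset.sum_neg_distrib, this]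
  simp only [Fintype.card_fin, Nat.cast_mul, Nat.cast_ofNat, ContinuousLinearMap.coe_coe]
  ring

/-- A conformally pseudo-hyper-Kähler metric satisfies the defining conditions of the class `𝒲`
at each point. -/
lemma classW_of_nablaEnd (hn : 1 ≤ n) {H : HypercomplexStructure n M}
    {g : BilinField n M} (hg : IsPseudoHermitianOn H g univ) {D : Conn n M} {p : M}
    {η : TangentSpace (𝓡 (4 * n)) p →ₗ[ℝ] ℝ} {s : TangentSpace (𝓡 (4 * n)) p}
    (hsη : ∀ z, g p s z = η z)
    (hN₁ : ∀ x y, nablaEnd D H.J₁ p x y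
      = -conformalDefect (fiberForm g p) (H.J₁ p).toLinearMap η s x y)
    (hN₂ : ∀ x y, nablaEnd D H.J₂ p x y
      = -conformalDefect (fiberForm g p) (H.J₂ p).toLinearMap η s x y)
    (hN₃ : ∀ x y, nablaEnd D H.J₃ p x y
      = -conformalDefect (fiberForm g p) (H.J₃ p).toLinearMap η s x y) :
    (∀ z, structForm g D H.J₁ p z = 2 * (2 * (n : ℝ) - 1) * η (H.J₁ p z)) ∧
    (∀ x y z : TangentSpace (𝓡 (4 * n)) p,
      structTensor g D H.J₁ p x y z
      = 1 / (2 * (2 * (n : ℝ) - 1)) *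
        (g p x y * structForm g D H.J₁ p z - g p x z * structForm g D H.J₁ p y
          - g p x (H.J₁ p y) * structForm g D H.J₁ p (H.J₁ p z)
          + g p x (H.J₁ p z) * structForm g D H.J₁ p (H.J₁ p y))) ∧
    (∀ x y z : TangentSpace (𝓡 (4 * n)) p,
      structTensor g D H.J₂ p x y z
      = 1 / (4 * (n : ℝ)) *
        (g p x y * structForm g D H.J₂ p z + g p x z * structForm g D H.J₂ p y
          + g p x (H.J₂ p y) * structForm g D H.J₂ p (H.J₂ p z)
          + g p x (H.J₂ p z) * structForm g D H.J₂ p (H.J₂ p y))) ∧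
    (∀ x y z : TangentSpace (𝓡 (4 * n)) p,
      structTensor g D H.J₃ p x y z
      = 1 / (4 * (n : ℝ)) *
        (g p x y * structForm g D H.J₃ p z + g p x z * structForm g D H.J₃ p y
          + g p x (H.J₃ p y) * structForm g D H.J₃ p (H.J₃ p z)
          + g p x (H.J₃ p z) * structForm g D H.J₃ p (H.J₃ p y))) := by
  have hp := mem_univ p
  have hs := hg.symm p hp
  have hB := hg.nondegenerate p hp
  have hn' : (1 : ℝ) ≤ n := by exact_mod_cast hn
  have k₁ : ∀ x y, g p (H.J₁ p x) y = -g p x (H.J₁ p y) := fun x y => by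
    have := hg.hermitian₁ p hp x (H.J₁ p y)
    rw [H.sq₁, map_neg] at this
    linarith
  have k₂ : ∀ x y, g p (H.J₂ p x) y = g p x (H.J₂ p y) := fun x y => by
    have := hg.skew₂ p hp x (H.J₂ p y)
    rw [H.sq₂, map_neg] at this
    linarith
  have k₃ : ∀ x y, g p (H.J₃ p x) y = g p x (H.J₃ p y) := fun x y => by
    have := hg.skew₃ p hp x (H.J₃ p y)
    rw [H.sq₃, map_neg] at this
    linarith
  have t₁ : LinearMap.trace ℝ _ (H.J₁ p).toLinearMap = 0 :=
    trace_eq_zero_of_anticommute (C := (H.J₃ p).toLinearMap) (H.sq₃ p) (H.mul₁₃ p)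
  have t₂ : LinearMap.trace ℝ _ (H.J₂ p).toLinearMap = 0 :=
    trace_eq_zero_of_anticommute (C := (H.J₁ p).toLinearMap) (H.sq₁ p) (fun x => by
      simp [H.mul₂₁, H.mul₁₂])
  have t₃ : LinearMap.trace ℝ _ (H.J₃ p).toLinearMap = 0 :=
    trace_eq_zero_of_anticommute (C := (H.J₁ p).toLinearMap) (H.sq₁ p) (fun x => by
      simp [H.mul₁₃])
  -- The trace coefficient `-(1 - ε + 4nε)` is `2(2n-1)` for `ε = -1` and `-4n` for `ε = 1`, which
  -- explains the normalising constants of the classes.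
  have θ₁ : ∀ z, structForm g D H.J₁ p z = 2 * (2 * (n : ℝ) - 1) * η (H.J₁ p z) := fun z => by
    rw [structForm_eq_of_nablaEnd hs hB (ε := -1) (by simpa using k₁) t₁ hsη hN₁]
    ring
  have θ₂ : ∀ z, structForm g D H.J₂ p z = -(4 * (n : ℝ)) * η (H.J₂ p z) := fun z => by
    rw [structForm_eq_of_nablaEnd hs hB (ε := 1) (by simpa using k₂) t₂ hsη hN₂]
    ring
  have θ₃ : ∀ z, structForm g D H.J₃ p z = -(4 * (n : ℝ)) * η (H.J₃ p z) := fun z => by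
    rw [structForm_eq_of_nablaEnd hs hB (ε := 1) (by simpa using k₃) t₃ hsη hN₃]
    ring
  refine ⟨θ₁, fun x y z => ?_, fun x y z => ?_, fun x y z => ?_⟩
  · rw [structTensor, hN₁, map_neg]
    exact hermitian_formula_of_eq_neg_conformalDefect (B := fiberForm g p)
      (J := (H.J₁ p).toLinearMap) (θ := (structForm g D H.J₁ p).toLinearMap) (H.sq₁ p) k₁
      (one_div_mul_cancel (by nlinarith)) θ₁ hsη x y z
  · rw [structTensor, hN₂, map_neg]
    exact norden_formula_of_eq_neg_conformalDefect (B := fiberForm g p)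
      (J := (H.J₂ p).toLinearMap) (θ := (structForm g D H.J₂ p).toLinearMap) (H.sq₂ p) k₂
      (one_div_mul_cancel (by positivity)) θ₂ hsη x y z
  · rw [structTensor, hN₃, map_neg]
    exact norden_formula_of_eq_neg_conformalDefect (B := fiberForm g p)
      (J := (H.J₃ p).toLinearMap) (θ := (structForm g D H.J₃ p).toLinearMap) (H.sq₃ p) k₃
      (one_div_mul_cancel (by positivity)) θ₃ hsη x y z

end

/-! ### Closed 1-forms: the local Poincaré lemma and symmetry of second derivatives. -/

section

section EuclideanForms

variable {E : Type*} [NormedAddCommGroup E] [NormedSpace ℝ E]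

/-- The differential of a closed 1-form read in coordinates. -/
lemma fderiv_apply_sub_fderiv_apply {φ : E → E →L[ℝ] ℝ} {X Y : E → E} {a : E}
    (hφ : DifferentiableAt ℝ φ a) (hX : DifferentiableAt ℝ X a) (hY : DifferentiableAt ℝ Y a) :
    fderiv ℝ (fun y => φ y (Y y)) a (X a) - fderiv ℝ (fun y => φ y (X y)) a (Y a)
      - φ a (VectorField.lieBracket ℝ X Y a)
      = fderiv ℝ φ a (X a) (Y a) - fderiv ℝ φ a (Y a) (X a) := by
  rw [(hφ.hasFDerivAt.clm_apply hY.hasFDerivAt).fderiv,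
    (hφ.hasFDerivAt.clm_apply hX.hasFDerivAt).fderiv]
  simp only [VectorField.lieBracket, add_apply, ContinuousLinearMap.comp_apply,
    ContinuousLinearMap.flip_apply, map_sub]
  ring

/-- A smooth closed 1-form on an open convex set has a smooth primitive. -/
lemma exists_contDiffOn_primitive [FiniteDimensional ℝ E] {φ : E → E →L[ℝ] ℝ} {s : Set E}
    (hs : Convex ℝ s) (hso : IsOpen s) (hφ : ContDiffOn ℝ ∞ φ s)
    (hsymm : ∀ a ∈ s, ∀ x y, fderiv ℝ φ a x y = fderiv ℝ φ a y x) :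
    ∃ f : E → ℝ, ContDiffOn ℝ ∞ f s ∧ ∀ a ∈ s, HasFDerivAt f (φ a) a := by
  obtain ⟨f, hf⟩ := hs.exists_forall_hasFDerivAt_of_fderiv_symmetric hso
    (hφ.differentiableOn (by simp)) hsymm
  refine ⟨f, ?_, hf⟩
  rw [contDiffOn_infty_iff_fderiv_of_isOpen hso]
  exact ⟨fun a ha => (hf a ha).differentiableAt.differentiableWithinAt,
    hφ.congr fun a ha => (hf a ha).fderiv⟩

end EuclideanForms

section ManifoldForms

variable {E : Type*} [NormedAddCommGroup E] [NormedSpace ℝ E] {M : Type*} [TopologicalSpace M]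
  [ChartedSpace E M]

/-- The vector field with constant coordinates `v` in the chart at `p₀`. -/
def coordField (p₀ : M) (v : E) (p : M) : TangentSpace 𝓘(ℝ, E) p :=
  VectorField.mpullback 𝓘(ℝ, E) 𝓘(ℝ, E) (extChartAt 𝓘(ℝ, E) p₀)
    (fun y => (v : TangentSpace 𝓘(ℝ, E) y)) p

variable [IsManifold 𝓘(ℝ, E) ∞ M]

lemma contMDiffAt_const_vectorField (v a : E) :
    ContMDiffAt 𝓘(ℝ, E) 𝓘(ℝ, E).tangent ∞
      (fun y => (⟨y, v⟩ : TangentBundle 𝓘(ℝ, E) E)) a :=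
  contMDiffAt_vectorSpace_iff_contDiffAt.2 contDiffAt_const

lemma mfderiv_extChartAt_coordField {p₀ p : M} (hp : p ∈ (extChartAt 𝓘(ℝ, E) p₀).source) (v : E) :
    mfderiv 𝓘(ℝ, E) 𝓘(ℝ, E) (extChartAt 𝓘(ℝ, E) p₀) p (coordField p₀ v p) = v :=
  (isInvertible_mfderiv_extChartAt hp).self_apply_inverse _

lemma contMDiffAt_coordField [CompleteSpace E] {p₀ p : M}
    (hp : p ∈ (extChartAt 𝓘(ℝ, E) p₀).source) (v : E) :
    ContMDiffAt 𝓘(ℝ, E) 𝓘(ℝ, E).tangent ∞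
      (fun q => (⟨q, coordField p₀ v q⟩ : TangentBundle 𝓘(ℝ, E) M)) p :=
  ContMDiffAt.mpullback_vectorField_preimage (n := ∞)
    (contMDiffAt_const_vectorField v _)
    (contMDiffAt_extChartAt' (by simpa using hp)) (isInvertible_mfderiv_extChartAt hp) (by simp)

lemma mlieBracket_const_vectorField (v w a : E) :
    VectorField.mlieBracket 𝓘(ℝ, E) (fun y => (v : TangentSpace 𝓘(ℝ, E) y))
      (fun y => (w : TangentSpace 𝓘(ℝ, E) y)) a = 0 := by
  refine (congrFun VectorField.mlieBracketWithin_univ a).symm.trans ?_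
  refine (congrFun (VectorField.mlieBracketWithin_eq_lieBracketWithin (𝕜 := ℝ)
    (V := fun _ => v) (W := fun _ => w) (s := univ)) a).trans ?_
  simp [VectorField.lieBracketWithin_univ, VectorField.lieBracket]
  rfl

/-- The bracket is natural under pullback by the chart, and constant fields on the model space
commute. -/
lemma mlieBracket_coordField [CompleteSpace E] {p₀ p : M}
    (hp : p ∈ (extChartAt 𝓘(ℝ, E) p₀).source) (v w : E) :
    VectorField.mlieBracket 𝓘(ℝ, E) (coordField p₀ v) (coordField p₀ w) p = 0 := by
  have : IsManifold 𝓘(ℝ, E) (minSmoothness ℝ 3) M := by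
    rw [minSmoothness_of_isRCLikeNormedField]
    exact .of_le (n := ∞) ENat.LEInfty.out
  have hd : ∀ v : E, MDifferentiableAt 𝓘(ℝ, E) 𝓘(ℝ, E).tangent
      (fun y => (⟨y, v⟩ : TangentBundle 𝓘(ℝ, E) E)) (extChartAt 𝓘(ℝ, E) p₀ p) := fun v =>
    (contMDiffAt_const_vectorField v _).mdifferentiableAt (by simp)
  refine (VectorField.mpullback_mlieBracket (n := ∞) (hd v) (hd w)
    (contMDiffAt_extChartAt' (by simpa using hp))
    (by rw [minSmoothness_of_isRCLikeNormedField]; exact ENat.LEInfty.out)).symm.trans ?_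
  rw [VectorField.mpullback_apply]
  exact (congrArg _ (mlieBracket_const_vectorField v w _)).trans (map_zero _)

/-- The local Poincaré lemma for smooth 1-forms on a manifold. -/
lemma exists_local_primitive [FiniteDimensional ℝ E] {φ : Π p : M, TangentSpace 𝓘(ℝ, E) p →L[ℝ] ℝ}
    (hφ : ContMDiff 𝓘(ℝ, E) (𝓘(ℝ, E).prod 𝓘(ℝ, E →L[ℝ] ℝ)) ∞
      (fun p => TotalSpace.mk' (E →L[ℝ] ℝ) p (φ p)))
    (hc : ∀ (p : M) (X Y : Π p : M, TangentSpace 𝓘(ℝ, E) p),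
      ContMDiffAt 𝓘(ℝ, E) 𝓘(ℝ, E).tangent ∞ (fun q => (⟨q, X q⟩ : TangentBundle 𝓘(ℝ, E) M)) p →
      ContMDiffAt 𝓘(ℝ, E) 𝓘(ℝ, E).tangent ∞ (fun q => (⟨q, Y q⟩ : TangentBundle 𝓘(ℝ, E) M)) p →
      mvfderiv 𝓘(ℝ, E) (fun q => φ q (Y q)) p (X p)
        - mvfderiv 𝓘(ℝ, E) (fun q => φ q (X q)) p (Y p)
        - φ p (VectorField.mlieBracket 𝓘(ℝ, E) X Y p) = 0) (p₀ : M) :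
    ∃ U : Set M, IsOpen U ∧ p₀ ∈ U ∧ ∃ u : M → ℝ, ContMDiffOn 𝓘(ℝ, E) 𝓘(ℝ, ℝ) ∞ u U ∧
      ∀ p ∈ U, mvfderiv 𝓘(ℝ, E) u p = φ p := by
  have : CompleteSpace E := FiniteDimensional.complete ℝ E
  set f := extChartAt 𝓘(ℝ, E) p₀ with hf
  have hfs : IsOpen f.source := isOpen_extChartAt_source p₀
  have hft : IsOpen f.target := isOpen_extChartAt_target p₀
  -- `ψ` is `φ` read in the chart at `p₀`. Testing closedness on the commuting coordinate fields
  -- will give symmetry of its derivative.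
  set ψ : E → E →L[ℝ] ℝ := fun y =>
    (φ (f.symm y)).comp (mfderiv 𝓘(ℝ, E) 𝓘(ℝ, E) f (f.symm y)).inverse with hψ
  have hψφ : ∀ q ∈ f.source, ∀ v, ψ (f q) v = φ q (coordField p₀ v q) := by
    intro q hq v
    -- The points `f.symm (f q)` and `q` index different tangent spaces, so the identity is
    -- transported along their equality.
    have : ∀ r, r = q → (φ r) ((mfderiv 𝓘(ℝ, E) 𝓘(ℝ, E) f r).inverse v)
        = φ q (coordField p₀ v q) := by
      rintro _ rfl
      rfl
    exact this _ (f.left_inv hq)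
  have hφψ : ∀ q ∈ f.source, ∀ x, φ q x = ψ (f q) (mfderiv 𝓘(ℝ, E) 𝓘(ℝ, E) f q x) := by
    intro q hq x
    exact (congrArg (φ q) ((isInvertible_mfderiv_extChartAt hq).inverse_apply_self x).symm).trans
      (hψφ q hq _).symm
  have hcoord : ∀ v, ContMDiffOn 𝓘(ℝ, E) 𝓘(ℝ, ℝ) ∞ (fun q => φ q (coordField p₀ v q)) f.source := by
    intro v q hq
    have := ContMDiffAt.clm_bundle_apply (E₂ := fun _ : M => ℝ) (hφ q) (contMDiffAt_coordField hq v)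
    rw [contMDiffAt_section] at this
    exact ContMDiffAt.contMDiffWithinAt this
  have hψs : ContDiffOn ℝ ∞ ψ f.target := by
    rw [contDiffOn_clm_apply]
    intro v
    have := (hcoord v).comp (contMDiffOn_extChartAt_symm p₀)
      fun y hy => f.map_target hy
    refine this.contDiffOn.congr fun y hy => ?_
    rw [← f.right_inv hy, hψφ _ (f.map_target hy), f.right_inv hy]
    rfl
  have hfm : ∀ q ∈ f.source, MDifferentiableAt 𝓘(ℝ, E) 𝓘(ℝ, E) f q := fun q hq =>
    mdifferentiableAt_extChartAt (by simpa [hf] using hq)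
  have hψd : ∀ y ∈ f.target, DifferentiableAt ℝ ψ y := fun y hy =>
    (hψs.contDiffAt (hft.mem_nhds hy)).differentiableAt (by simp)
  have hder : ∀ q ∈ f.source, ∀ v w, mvfderiv 𝓘(ℝ, E) (fun q => φ q (coordField p₀ w q)) q
      (coordField p₀ v q) = fderiv ℝ ψ (f q) v w := by
    intro q hq v w
    have h1 : HasFDerivAt (fun y => ψ y w) ((fderiv ℝ ψ (f q)).flip w) (f q) := by
      simpa using ((hψd _ (f.map_source hq)).hasFDerivAt.clm_apply (hasFDerivAt_const w (f q)))
    have h2 := (h1.hasMFDerivAt.comp q (hfm q hq).hasMFDerivAt).congr_of_eventuallyEq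
      (f₁ := fun q => φ q (coordField p₀ w q))
      (by filter_upwards [hfs.mem_nhds hq] with r hr using (hψφ r hr w).symm)
    refine (congrArg (fun L => L (coordField p₀ v q)) h2.mfderiv).trans ?_
    change fderiv ℝ ψ (f q) (mfderiv 𝓘(ℝ, E) 𝓘(ℝ, E) f q (coordField p₀ v q)) w = _
    rw [mfderiv_extChartAt_coordField hq]
  -- A ball inside the chart's target is convex, as the Euclidean primitive requires.
  obtain ⟨r, hr, hball⟩ := Metric.isOpen_iff.1 hft (f p₀) (mem_extChartAt_target p₀)
  obtain ⟨h, hhs, hh⟩ := exists_contDiffOn_primitive (convex_ball (f p₀) r) Metric.isOpen_ball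
    (hψs.mono hball) (fun y hy v w => by
      have hq := f.map_target (hball hy)
      have := hc (f.symm y) (coordField p₀ v) (coordField p₀ w) (contMDiffAt_coordField hq v)
        (contMDiffAt_coordField hq w)
      rw [mlieBracket_coordField hq, map_zero, sub_zero, hder _ hq, hder _ hq,
        f.right_inv (hball hy)] at this
      exact sub_eq_zero.1 this)
  refine ⟨f.source ∩ f ⁻¹' Metric.ball (f p₀) r,
    (continuousOn_extChartAt p₀).isOpen_inter_preimage hfs Metric.isOpen_ball,
    ⟨mem_extChartAt_source p₀, Metric.mem_ball_self hr⟩, h ∘ f, ?_, ?_⟩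
  · exact hhs.contMDiffOn.comp
      ((contMDiffOn_extChartAt (x := p₀)).mono fun q hq => by simpa [hf] using hq.1) fun q hq => hq.2
  · intro q hq
    have := ((hh _ hq.2).hasMFDerivAt.comp q (hfm q hq.1).hasMFDerivAt).mfderiv
    ext x
    rw [hφψ q hq.1]
    exact congrArg (fun L => L x) this

/-- Second derivatives of a function on a manifold: `X(Yu) - Y(Xu) - [X,Y]u = 0`. -/
lemma mvfderiv_mvfderiv_sub [CompleteSpace E] {u : M → ℝ} {p : M}
    {X Y : Π p : M, TangentSpace 𝓘(ℝ, E) p} (hu : ContMDiffAt 𝓘(ℝ, E) 𝓘(ℝ, ℝ) ∞ u p)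
    (hX : MDifferentiableAt 𝓘(ℝ, E) 𝓘(ℝ, E).tangent
      (fun q => (⟨q, X q⟩ : TangentBundle 𝓘(ℝ, E) M)) p)
    (hY : MDifferentiableAt 𝓘(ℝ, E) 𝓘(ℝ, E).tangent
      (fun q => (⟨q, Y q⟩ : TangentBundle 𝓘(ℝ, E) M)) p) :
    mvfderiv 𝓘(ℝ, E) (fun q => mvfderiv 𝓘(ℝ, E) u q (Y q)) p (X p)
      - mvfderiv 𝓘(ℝ, E) (fun q => mvfderiv 𝓘(ℝ, E) u q (X q)) p (Y p)
      - mvfderiv 𝓘(ℝ, E) u p (VectorField.mlieBracket 𝓘(ℝ, E) X Y p) = 0 := by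
  set f := extChartAt 𝓘(ℝ, E) p with hf
  have hfs : f.source ∈ 𝓝 p := extChartAt_source_mem_nhds p
  have hps : p ∈ f.source := mem_extChartAt_source p
  have hfm : ∀ q ∈ f.source, MDifferentiableAt 𝓘(ℝ, E) 𝓘(ℝ, E) f q := fun q hq =>
    mdifferentiableAt_extChartAt (by simpa [hf] using hq)
  set v : E → ℝ := u ∘ f.symm with hv
  have hvs : ContDiffAt ℝ ∞ v (f p) := by
    have h1 : ContMDiffAt 𝓘(ℝ, E) 𝓘(ℝ, E) ∞ f.symm (f p) :=
      (contMDiffOn_extChartAt_symm p).contMDiffAt (extChartAt_target_mem_nhds p)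
    exact (ContMDiffAt.comp (f p) (by rwa [f.left_inv hps]) h1).contDiffAt
  have hvd : ∀ᶠ q in 𝓝 p, DifferentiableAt ℝ v (f q) :=
    (continuousAt_extChartAt p).eventually
      (((hvs.of_le (m := 1) (by simp)).eventually (by simp)).mono
        fun y hy => hy.differentiableAt (by simp))
  have hdu : ∀ᶠ q in 𝓝 p, ∀ x, mvfderiv 𝓘(ℝ, E) u q x
      = fderiv ℝ v (f q) (mfderiv 𝓘(ℝ, E) 𝓘(ℝ, E) f q x) := by
    filter_upwards [hvd, eventually_mem_nhds_iff.2 hfs] with q hq hqs x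
    have h2 := (hq.hasFDerivAt.hasMFDerivAt.comp q
      (hfm q (mem_of_mem_nhds hqs)).hasMFDerivAt).congr_of_eventuallyEq (f₁ := u)
      (by filter_upwards [hqs] with r hr using
        (congrArg u (f.left_inv hr)).symm)
    exact congrArg (fun L => L x) h2.mfderiv
  set X' : E → E := VectorField.mpullbackWithin 𝓘(ℝ, E) 𝓘(ℝ, E) f.symm X (range 𝓘(ℝ, E)) with hX'
  set Y' : E → E := VectorField.mpullbackWithin 𝓘(ℝ, E) 𝓘(ℝ, E) f.symm Y (range 𝓘(ℝ, E)) with hY'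
  have hXd : DifferentiableAt ℝ X' (f p) := by
    have := (MDifferentiableWithinAt.differentiableWithinAt_mpullbackWithin_vectorField
      (s := univ) hX.mdifferentiableWithinAt)
    exact this.differentiableAt (by simp)
  have hYd : DifferentiableAt ℝ Y' (f p) := by
    have := (MDifferentiableWithinAt.differentiableWithinAt_mpullbackWithin_vectorField
      (s := univ) hY.mdifferentiableWithinAt)
    exact this.differentiableAt (by simp)
  have hXe : ∀ᶠ q in 𝓝 p, mfderiv 𝓘(ℝ, E) 𝓘(ℝ, E) f q (X q) = X' (f q) := by
    have := VectorField.eventuallyEq_mpullback_mpullbackWithin_extChartAt (s := univ) (x := p) X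
    rw [nhdsWithin_univ] at this
    filter_upwards [this, hfs] with q hq hqs
    rw [hq]
    exact (isInvertible_mfderiv_extChartAt hqs).self_apply_inverse _
  have hYe : ∀ᶠ q in 𝓝 p, mfderiv 𝓘(ℝ, E) 𝓘(ℝ, E) f q (Y q) = Y' (f q) := by
    have := VectorField.eventuallyEq_mpullback_mpullbackWithin_extChartAt (s := univ) (x := p) Y
    rw [nhdsWithin_univ] at this
    filter_upwards [this, hfs] with q hq hqs
    rw [hq]
    exact (isInvertible_mfderiv_extChartAt hqs).self_apply_inverse _
  have hdv : DifferentiableAt ℝ (fderiv ℝ v) (f p) :=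
    (hvs.fderiv_right (m := 1) (by rw [one_add_one_eq_two]; exact ENat.LEInfty.out)).differentiableAt
      (by simp)
  have hcomp : ∀ {Z : Π p : M, TangentSpace 𝓘(ℝ, E) p} {Z' : E → E},
      (∀ᶠ q in 𝓝 p, mfderiv 𝓘(ℝ, E) 𝓘(ℝ, E) f q (Z q) = Z' (f q)) →
      DifferentiableAt ℝ Z' (f p) → ∀ x, mvfderiv 𝓘(ℝ, E) (fun q => mvfderiv 𝓘(ℝ, E) u q (Z q)) p x
        = fderiv ℝ (fun y => fderiv ℝ v y (Z' y)) (f p) (mfderiv 𝓘(ℝ, E) 𝓘(ℝ, E) f p x) := by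
    intro Z Z' hZ hZd x
    have h1 : DifferentiableAt ℝ (fun y => fderiv ℝ v y (Z' y)) (f p) := hdv.clm_apply hZd
    have h2 := (h1.hasFDerivAt.hasMFDerivAt.comp p (hfm p hps).hasMFDerivAt).congr_of_eventuallyEq
      (f₁ := fun q => mvfderiv 𝓘(ℝ, E) u q (Z q))
      (by filter_upwards [hZ, hdu] with q hq hq' using
        (hq' _).trans (congrArg _ hq))
    exact congrArg (fun L => L x) h2.mfderiv
  have hbr : mvfderiv 𝓘(ℝ, E) u p (VectorField.mlieBracket 𝓘(ℝ, E) X Y p)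
      = fderiv ℝ v (f p) (VectorField.lieBracket ℝ X' Y' (f p)) := by
    have hset : f.symm ⁻¹' univ ∩ range 𝓘(ℝ, E) = univ := by simp
    obtain ⟨b, hb'⟩ : ∃ b : E, b = VectorField.lieBracket ℝ X' Y' (f p) := ⟨_, rfl⟩
    -- By definition, the bracket on `M` is the chart pullback of the bracket of the coordinate
    -- representatives `X'` and `Y'`.
    have e : VectorField.mlieBracket 𝓘(ℝ, E) X Y p
        = (mfderiv 𝓘(ℝ, E) 𝓘(ℝ, E) f p).inverse b := by
      have hb : b = VectorField.lieBracketWithin ℝ X' Y'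
          (f.symm ⁻¹' univ ∩ range 𝓘(ℝ, E)) (f p) := by
        rw [hset, VectorField.lieBracketWithin_univ, hb']
      exact (congrArg (mfderiv 𝓘(ℝ, E) 𝓘(ℝ, E) f p).inverse hb).symm
    rw [hdu.self_of_nhds, e, ← hb']
    exact congrArg _ ((isInvertible_mfderiv_extChartAt hps).self_apply_inverse _)
  rw [hcomp hXe hXd, hcomp hYe hYd, hbr, hXe.self_of_nhds, hYe.self_of_nhds,
    fderiv_apply_sub_fderiv_apply hdv hXd hYd, sub_eq_zero]
  exact (hvs.isSymmSndFDerivAt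
    (by rw [minSmoothness_of_isRCLikeNormedField]; exact ENat.LEInfty.out)) _ _

/-- The differential of a smooth function is a smooth section of the cotangent bundle. -/
lemma contMDiffAt_mvfderiv {u : M → ℝ} {p : M} (hu : ContMDiffAt 𝓘(ℝ, E) 𝓘(ℝ, ℝ) ∞ u p) :
    ContMDiffAt 𝓘(ℝ, E) (𝓘(ℝ, E).prod 𝓘(ℝ, E →L[ℝ] ℝ)) ∞
      (fun q => TotalSpace.mk' (E →L[ℝ] ℝ) (E := fun q : M => TangentSpace 𝓘(ℝ, E) q →L[ℝ] ℝ)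
        q (mvfderiv 𝓘(ℝ, E) u q)) p := by
  rw [contMDiffAt_hom_bundle]
  refine ⟨contMDiffAt_id, ?_⟩
  have := hu.mfderiv_const (m := ∞) (by simp)
  refine this.congr_of_eventuallyEq (Filter.Eventually.of_forall fun q => ?_)
  ext v
  simp [inTangentCoordinates, ContinuousLinearMap.inCoordinates, mvfderiv]
  rfl

end ManifoldForms

end

/-! ### Uniqueness of the Levi-Civita connection and the two directions of the theorem. -/

section

variable {n : ℕ} {M : Type*} [TopologicalSpace M]
  [ChartedSpace (EuclideanSpace ℝ (Fin (4 * n))) M] [IsManifold (𝓡 (4 * n)) ∞ M]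

lemma SmoothFieldAt.diffFieldAt {X : VField n M} {p : M} (hX : SmoothFieldAt X p) :
    DiffFieldAt X p :=
  ContMDiffAt.mdifferentiableAt hX (by simp)

/-- A 1-form which is locally a constant multiple of a differential is closed. -/
lemma isClosedForm_of_local_primitive {φ : OneForm n M} (c : ℝ)
    (h : ∀ p : M, ∃ U : Set M, IsOpen U ∧ p ∈ U ∧ ∃ u : M → ℝ,
      ContMDiffOn (𝓡 (4 * n)) 𝓘(ℝ, ℝ) ∞ u U ∧
        ∀ q ∈ U, φ q = c • mvfderiv (𝓡 (4 * n)) u q) : IsClosedForm φ where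
  smooth := by
    intro p
    obtain ⟨U, hU, hp, u, hu, hφ⟩ := h p
    have h1 := contMDiffAt_mvfderiv (hu.contMDiffAt (hU.mem_nhds hp))
    have h2 := ContMDiffAt.const_smul_section (a := c) h1
    refine ContMDiffAt.congr_of_eventuallyEq h2 ?_
    filter_upwards [hU.mem_nhds hp] with q hq
    rw [hφ q hq]
    rfl
  closed := by
    intro p X Y hX hY
    obtain ⟨U, hU, hp, u, hu, hφ⟩ := h p
    have hup := hu.contMDiffAt (hU.mem_nhds hp)
    have key := mvfderiv_mvfderiv_sub hup hX.diffFieldAt hY.diffFieldAt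
    have hmul : ∀ Z : VField n M, SmoothFieldAt Z p → ∀ x,
        mvfderiv (𝓡 (4 * n)) (fun q => φ q (Z q)) p x
          = c * mvfderiv (𝓡 (4 * n)) (fun q => mvfderiv (𝓡 (4 * n)) u q (Z q)) p x := by
      intro Z hZ x
      have hd : MDifferentiableAt (𝓡 (4 * n)) 𝓘(ℝ, ℝ)
          (fun q => mvfderiv (𝓡 (4 * n)) u q (Z q)) p := by
        have := ContMDiffAt.clm_bundle_apply (E₂ := fun _ : M => ℝ) (contMDiffAt_mvfderiv hup) hZ
        rw [contMDiffAt_section] at this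
        exact ContMDiffAt.mdifferentiableAt this (by simp)
      have h1 : HasMFDerivAt (𝓡 (4 * n)) 𝓘(ℝ, ℝ) (fun q => φ q (Z q)) p
          (c • mfderiv (𝓡 (4 * n)) 𝓘(ℝ, ℝ) (fun q => mvfderiv (𝓡 (4 * n)) u q (Z q)) p) := by
        refine (hd.hasMFDerivAt.const_smul c).congr_of_eventuallyEq ?_
        filter_upwards [hU.mem_nhds hp] with q hq
        rw [hφ q hq]
        rfl
      exact congrArg (fun L => L x) h1.mfderiv
    rw [hmul Y hY, hmul X hX, hφ p hp, smul_apply, smul_eq_mul]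
    linear_combination c * key

lemma isPseudoHyperKahlerOn_of_solvesPotentialEq (hn : 1 ≤ n) {H : HypercomplexStructure n M}
    {g : BilinField n M} (hg : IsPseudoHermitianOn H g univ) {D : Conn n M}
    (hD : IsLeviCivitaOn g D univ) (hW : InClassW H g D) {U : Set M} {u : M → ℝ}
    (hU : IsOpen U) (hu : ContMDiffOn (𝓡 (4 * n)) 𝓘(ℝ, ℝ) ∞ u U)
    (hsol : SolvesPotentialEq H g D u U) : IsPseudoHyperKahlerOn H (conformal u g) U := by
  have hgU := hg.mono (subset_univ U)
  have hDU : IsLeviCivitaOn g D U :=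
    ⟨hD.isCovariantDerivativeOn.mono (subset_univ U), fun p _ => hD.torsion_free p (mem_univ p),
      fun p _ => hD.metric p (mem_univ p)⟩
  exact ⟨hgU.conformal hu, conformalConn g u D,
    isLeviCivitaOn_conformalConn hU hgU.smooth hgU.symm hgU.nondegenerate hu hDU,
    fun p hp x y => nablaEnd_conformalConn_eq_zero hn hg hD hW (hsol p hp) x y⟩

lemma exists_solution_potentialEq {H : HypercomplexStructure n M}
    {g : BilinField n M} {D : Conn n M}
    (hc : IsClosedForm (compEnd (structForm g D H.J₁) H.J₁)) (p : M) :
    ∃ U : Set M, IsOpen U ∧ p ∈ U ∧ ∃ u : M → ℝ,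
      ContMDiffOn (𝓡 (4 * n)) 𝓘(ℝ, ℝ) ∞ u U ∧ SolvesPotentialEq H g D u U := by
  obtain ⟨U, hU, hp, u, hu, hd⟩ := exists_local_primitive hc.smooth hc.closed p
  -- The Poincaré lemma gives a primitive of `θ₁∘J₁` itself; rescaling it by `c` solves the
  -- potential equation.
  set c := -(1 / (2 * (2 * (n : ℝ) - 1))) with hcdef
  refine ⟨U, hU, hp, fun q => c * u q, contMDiffOn_const.mul hu, fun q hq x => ?_⟩
  have hud : MDifferentiableAt (𝓡 (4 * n)) 𝓘(ℝ, ℝ) u q :=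
    (hu.contMDiffAt (hU.mem_nhds hq)).mdifferentiableAt (by simp)
  have := (hud.hasMFDerivAt.const_smul c).mfderiv
  refine (congrArg (fun L => L x) this).trans ?_
  rw [← hd q hq]
  rfl

/-- Uniqueness of the Levi-Civita connection. -/
lemma IsLeviCivitaOn.apply_eq {g : BilinField n M} {D D' : Conn n M} {U V : Set M}
    (hD : IsLeviCivitaOn g D U) (hD' : IsLeviCivitaOn g D' V) {p : M} (hU : p ∈ U) (hV : p ∈ V)
    (hs : ∀ x y, g p x y = g p y x) (hnd : ∀ x, (∀ y, g p x y = 0) → x = 0)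
    {Y : VField n M} (hY : DiffFieldAt Y p) : D Y p = D' Y p := by
  have hm : ∀ Y Z, DiffFieldAt Y p → DiffFieldAt Z p → ∀ x,
      g p (D Y p x - D' Y p x) (Z p) = -g p (D Z p x - D' Z p x) (Y p) := by
    intro Y Z hY hZ x
    have h1 := hD.metric p hU x Y Z hY hZ
    have h2 := hD'.metric p hV x Y Z hY hZ
    simp only [map_sub, sub_apply]
    rw [hs (Y p), h1] at h2
    rw [hs (Y p)] at h2
    linarith
  set e := fun y : TangentSpace (𝓡 (4 * n)) p =>
    FiberBundle.extend (EuclideanSpace ℝ (Fin (4 * n))) y with he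
  have hee : ∀ y, e y p = y := fun y => FiberBundle.extend_apply_self ..
  set S := fun x y z => g p (D (e y) p x - D' (e y) p x) z with hS
  have hsymm : ∀ x y z, S x y z = S y x z := by
    intro x y z
    have h1 := hD.torsion_free p hU (e x) (e y) (diffFieldAt_extend x) (diffFieldAt_extend y)
    have h2 := hD'.torsion_free p hV (e x) (e y) (diffFieldAt_extend x) (diffFieldAt_extend y)
    rw [hee, hee, ← h1, hee, hee, sub_eq_sub_iff_sub_eq_sub] at h2
    simp only [hS]
    rw [← neg_sub (D' (e y) p x), h2, neg_sub]
  have hskew : ∀ x y z, S x y z = -S x z y := by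
    intro x y z
    simpa only [hee] using hm (e y) (e z) (diffFieldAt_extend y) (diffFieldAt_extend z) x
  -- A trilinear difference that is symmetric in the first two slots and skew in the last two
  -- vanishes: six alternating swaps return `S x y z` with the opposite sign.
  have hzero : ∀ x y z, S x y z = 0 := by
    intro x y z
    have h1 := hskew x y z
    have h2 := hsymm x z y
    have h3 := hskew z x y
    have h4 := hsymm z y x
    have h5 := hskew y z x
    have h6 := hsymm y x z
    linarith
  ext1 x
  rw [← sub_eq_zero]
  refine hnd _ fun z => ?_
  -- Metric compatibility moves the difference off the arbitrary field `Y` onto an extension of `z`,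
  -- so only the value `Y p` matters.
  have := hm Y (e z) hY (diffFieldAt_extend z) x
  rw [hee] at this
  rw [this, neg_eq_zero]
  exact hzero x z (Y p)

lemma IsLeviCivitaOn.nablaEnd_eq {g : BilinField n M} {D D' : Conn n M} {U V : Set M}
    (hD : IsLeviCivitaOn g D U) (hD' : IsLeviCivitaOn g D' V) {p : M} (hU : p ∈ U) (hV : p ∈ V)
    (hs : ∀ x y, g p x y = g p y x) (hnd : ∀ x, (∀ y, g p x y = 0) → x = 0) {J : EndField n M}
    (hJ : ContMDiff (𝓡 (4 * n)) ((𝓡 (4 * n)).prod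
      𝓘(ℝ, EuclideanSpace ℝ (Fin (4 * n)) →L[ℝ] EuclideanSpace ℝ (Fin (4 * n)))) ∞
      (fun p => TotalSpace.mk'
        (EuclideanSpace ℝ (Fin (4 * n)) →L[ℝ] EuclideanSpace ℝ (Fin (4 * n))) p (J p)))
    (x y : TangentSpace (𝓡 (4 * n)) p) : nablaEnd D J p x y = nablaEnd D' J p x y := by
  have hy := diffFieldAt_extend y
  rw [nablaEnd, nablaEnd, hD.apply_eq hD' hU hV hs hnd hy,
    hD.apply_eq hD' hU hV hs hnd (diffFieldAt_appEnd hJ hy)]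

/-- The conformal change of a parallel endomorphism field, in terms of the original metric. -/
lemma nablaEnd_conformalConn_neg {g : BilinField n M} {D : Conn n M} {J : EndField n M}
    {u : M → ℝ} {p : M} {s : TangentSpace (𝓡 (4 * n)) p} (hnd : ∀ x, (∀ y, g p x y = 0) → x = 0)
    (hs : ∀ z, g p s z = mvfderiv (𝓡 (4 * n)) u p z) {x y : TangentSpace (𝓡 (4 * n)) p}
    (h : nablaEnd D J p x y = 0) :
    nablaEnd (conformalConn (conformal u g) (fun q => -u q) D) J p x y
      = -conformalDefect (fiberForm g p) (J p).toLinearMap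
        (mvfderiv (𝓡 (4 * n)) u p).toLinearMap s x y := by
  have hneg : mvfderiv (𝓡 (4 * n)) (fun q => -u q) p = -mvfderiv (𝓡 (4 * n)) u p :=
    mvfderiv_fun_neg
  set t := sharp (conformal u g) (mvfderiv (𝓡 (4 * n)) (fun q => -u q)) p with ht
  -- Scaling the metric by `e^{2u}` scales the dual vector by `e^{-2u}`, and the sign comes from
  -- `-u`. In the defect this factor cancels the one in the metric, so the result involves `g`
  -- alone.
  have hst : s = -Real.exp (2 * u p) • t := by
    rw [← sub_eq_zero]
    refine hnd _ fun z => ?_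
    have := apply_sharp (g := conformal u g) (p := p) (fun x hx => hnd x fun y => by
      simpa [conformal, Real.exp_ne_zero] using hx y) (mvfderiv (𝓡 (4 * n)) (fun q => -u q)) z
    rw [hneg] at this
    simp only [conformal, smul_apply, smul_eq_mul, neg_apply, ← ht] at this
    simp only [map_sub, map_neg, map_smul, neg_smul, sub_apply, neg_apply, smul_apply, hs,
      smul_eq_mul, this]
    ring
  rw [nablaEnd_conformalConn, h, zero_add, hneg, hst]
  simp only [conformalDefect, fiberForm_apply, conformal, ContinuousLinearMap.coe_coe, neg_apply,
    smul_apply, smul_eq_mul, map_smul]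
  module

/-- A locally conformally pseudo-hyper-Kähler manifold is of class `𝒲⁰`: the Levi-Civita
connection is obtained by undoing the conformal changes. -/
lemma isWZero_of_isLocallyConformallyPseudoHyperKahler (hn : 1 ≤ n)
    {H : HypercomplexStructure n M} {g : BilinField n M} (hg : IsPseudoHermitianOn H g univ)
    (h : IsLocallyConformallyPseudoHyperKahler H g) : IsWZero H g := by
  choose U hU hpU u hu hgu D' hD' hK using h
  set D : M → Conn n M := fun p => conformalConn (conformal (u p) g) (fun q => -u p q) (D' p)
    with hDdef
  have hDp : ∀ p, IsLeviCivitaOn g (D p) (U p) := fun p => by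
    have := isLeviCivitaOn_conformalConn (hU p) (hgu p).smooth (hgu p).symm (hgu p).nondegenerate
      (u := fun q => -u p q) (hu p).neg (hD' p)
    rwa [conformal_neg_conformal] at this
  -- The Levi-Civita conditions are imposed point by point, so using at `p` the connection belonging
  -- to `U p` already gives a global one. Uniqueness is needed only to compare it with `D p` at the
  -- other points of `U p`.
  set D₀ : Conn n M := fun Y p => D p Y p with hD₀
  have hL : IsLeviCivitaOn g D₀ univ :=
    { isCovariantDerivativeOn :=
        { add := fun {X Y p} hX hY _ => (hDp p).isCovariantDerivativeOn.add hX hY (hpU p)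
          leibniz := fun {X f p} hX hf _ =>
            (hDp p).isCovariantDerivativeOn.leibniz hX hf (hpU p) }
      torsion_free := fun p _ => (hDp p).torsion_free p (hpU p)
      metric := fun p _ => (hDp p).metric p (hpU p) }
  have hnabla : ∀ p, ∀ q ∈ U p, ∀ J : EndField n M, ContMDiff (𝓡 (4 * n)) ((𝓡 (4 * n)).prod
      𝓘(ℝ, EuclideanSpace ℝ (Fin (4 * n)) →L[ℝ] EuclideanSpace ℝ (Fin (4 * n)))) ∞
      (fun p => TotalSpace.mk'
        (EuclideanSpace ℝ (Fin (4 * n)) →L[ℝ] EuclideanSpace ℝ (Fin (4 * n))) p (J p)) →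
      (∀ x y, nablaEnd (D' p) J q x y = 0) → ∀ x y, nablaEnd D₀ J q x y
        = -conformalDefect (fiberForm g q) (J q).toLinearMap
          (mvfderiv (𝓡 (4 * n)) (u p) q).toLinearMap
          (sharp g (mvfderiv (𝓡 (4 * n)) (u p)) q) x y := by
    intro p q hq J hJ hpar x y
    have hnd := hg.nondegenerate q (mem_univ q)
    rw [hL.nablaEnd_eq (hDp p) (mem_univ q) hq (hg.symm q (mem_univ q)) hnd hJ]
    exact nablaEnd_conformalConn_neg hnd (apply_sharp hnd _) (hpar x y)
  have hW := fun p q (hq : q ∈ U p) => classW_of_nablaEnd hn hg (D := D₀) (p := q)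
    (η := (mvfderiv (𝓡 (4 * n)) (u p) q).toLinearMap)
    (s := sharp g (mvfderiv (𝓡 (4 * n)) (u p)) q)
    (apply_sharp (hg.nondegenerate q (mem_univ q)) _)
    (hnabla p q hq H.J₁ H.smooth₁ fun x y => (hK p q hq x y).1)
    (hnabla p q hq H.J₂ H.smooth₂ fun x y => (hK p q hq x y).2.1)
    (hnabla p q hq H.J₃ H.smooth₃ fun x y => (hK p q hq x y).2.2)
  -- The constant arises from `θ₁(J₁ x) = 2(2n-1) du(J₁ J₁ x) = -2(2n-1) du(x)`, which holds on all
  -- of `U p` and hence gives closedness.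
  refine ⟨D₀, hL, ⟨fun p => (hW p p (hpU p)).2.1, fun p => (hW p p (hpU p)).2.2.1,
    fun p => (hW p p (hpU p)).2.2.2⟩,
    isClosedForm_of_local_primitive (-(2 * (2 * (n : ℝ) - 1)))
      fun p => ⟨U p, hU p, hpU p, u p, hu p, fun q hq => ?_⟩⟩
  ext x
  change structForm g D₀ H.J₁ q (H.J₁ q x) = _
  rw [(hW p q hq).1, H.sq₁]
  simp

end

end PseudoHyper

end

theorem mainTheorem3 (n : ℕ) (hn : 1 ≤ n) (M : Type*) [TopologicalSpace M] [T2Space M]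
    [SecondCountableTopology M] [ChartedSpace (EuclideanSpace ℝ (Fin (4 * n))) M]
    [IsManifold (𝓡 (4 * n)) ∞ M]
    (H : PseudoHyper.HypercomplexStructure n M) (g : PseudoHyper.BilinField n M)
    (hg : PseudoHyper.IsPseudoHermitianOn H g univ) :
    (PseudoHyper.IsWZero H g ↔ PseudoHyper.IsLocallyConformallyPseudoHyperKahler H g) ∧
    ∀ D : PseudoHyper.Conn n M, PseudoHyper.IsLeviCivitaOn g D univ →
      PseudoHyper.InClassWZero H g D →
      (∀ p : M, ∃ U : Set M, IsOpen U ∧ p ∈ U ∧ ∃ u : M → ℝ,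
        ContMDiffOn (𝓡 (4 * n)) 𝓘(ℝ, ℝ) ∞ u U ∧ PseudoHyper.SolvesPotentialEq H g D u U) ∧
      ∀ (U : Set M) (u : M → ℝ), IsOpen U → ContMDiffOn (𝓡 (4 * n)) 𝓘(ℝ, ℝ) ∞ u U →
        PseudoHyper.SolvesPotentialEq H g D u U →
        PseudoHyper.IsPseudoHyperKahlerOn H (PseudoHyper.conformal u g) U := by
  refine ⟨⟨?_, PseudoHyper.isWZero_of_isLocallyConformallyPseudoHyperKahler hn hg⟩, ?_⟩
  · rintro ⟨D, hD, hW, hc⟩ p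
    obtain ⟨U, hU, hp, u, hu, hsol⟩ := PseudoHyper.exists_solution_potentialEq hc p
    exact ⟨U, hU, hp, u, hu,
      PseudoHyper.isPseudoHyperKahlerOn_of_solvesPotentialEq hn hg hD hW hU hu hsol⟩
  · intro D hD hW
    exact ⟨PseudoHyper.exists_solution_potentialEq hW.2, fun U u hU hu hsol =>
      PseudoHyper.isPseudoHyperKahlerOn_of_solvesPotentialEq hn hg hD hW.1 hU hu hsol⟩
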